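/- Let $\mathcal T$ be a finite tree with edges $e_j$ ($j\in J$, $J\neq\emptyset$), each $e_j$ being identified with an interval $[0,\ell_j]$, $0<\ell_j<\infty$, and with a root $\mathcal R$ that lies on exactly one edge. For a vertex $a_k$ let $J_k$ be the set of indices of the edges adjacent to $a_k$, and put $d_{kj}=1$ if $a_k$ is the end $x=\ell_j$ of $e_j$, $d_{kj}=-1$ if it is the end $x=0$, and $d_{kj}=0$ otherwise. Let $I_{\mathcal M}$ index the interior vertices (those lying on at least two edges) and $I_{\mathcal S}$ the leaves (the vertices other than $\mathcal R$ lying on exactly one edge); for $k\in I_{\mathcal S}$ write $J_k=\{j_k\}$. Let $$V=\Big\{y\in\prod_{j\in J}H^1(0,\ell_j):\ y(\mathcal R)=0,\ y^i(a_k)=y^j(a_k)\ \text{for } i,j\in J_k,\ k\in I_{\mathcal M}\Big\},\qquad H=V\times\prod_{j\in J}L^2(0,\ell_j)\times(\mathbb C^{I_{\mathcal M}})^2$$ (complex-valued functions), and let $\mathcal A$ be the unbounded operator on $H$ $$\mathcal A(y,v,p,q)=\Big(v,\ \tfrac{d^2y}{dx^2},\ q,\ -p-(v(a_k))_{k\in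 I_{\mathcal M}}\Big),$$ whose domain $\mathcal D(\mathcal A)$ consists of all $(y,v,p,q)\in\big[\prod_{j}H^2(0,\ell_j)\cap V\big]\times V\times(\mathbb C^{I_{\mathcal M}})^2$ with $$\sum_{j\in J_k}d_{kj}\frac{dy^j}{dx}(a_k)=q_k\ \ (k\in I_{\mathcal M}),\qquad d_{kj_k}\frac{dy^{j_k}}{dx}(a_k)=-v^{j_k}(a_k)\ \ (k\in I_{\mathcal S}).$$ Call $\mathcal T$ a Pi-tree if no edge of $\mathcal T$ has length $m\pi$ with $m\in\mathbb N^*=\{1,2,\dots\}$, except possibly edges attached to a leaf (the root does not count as a leaf). Then the spectrum of $\mathcal A$ contains no point of the imaginary axis $\mathbf i\mathbb R$ if and only if $\mathcal T$ is a Pi-tree. -/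

import Mathlib

open MeasureTheory Set
open scoped ContDiff

noncomputable section

namespace FluidTree

/-! ## Sobolev spaces on an interval -/

/-- The complex Lebesgue space `L²(0, ℓ)`. -/
abbrev L2 (ℓ : ℝ) : Type := Lp ℂ 2 (volume.restrict (Ioo 0 ℓ))

/-- `g` is the weak derivative of `f` on `(0, ℓ)`: for every smooth `φ` with compact support
in `(0, ℓ)` one has `∫ φ' f = - ∫ φ g`. -/
def HasWeakDeriv {ℓ : ℝ} (f g : L2 ℓ) : Prop :=
  ∀ φ : ℝ → ℝ, ContDiff ℝ ∞ φ → HasCompactSupport φ → tsupport φ ⊆ Ioo 0 ℓ →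
    ∫ x in Ioo 0 ℓ, deriv φ x • f x = - ∫ x in Ioo 0 ℓ, φ x • g x

lemma L2.integrableOn {ℓ : ℝ} (f : L2 ℓ) : IntegrableOn f (Ioo 0 ℓ) :=
  (Lp.memLp f).integrable (by norm_num)

lemma integrable_smul_test {ℓ : ℝ} {φ : ℝ → ℝ} (hφ : Continuous φ) (hc : HasCompactSupport φ)
    (f : L2 ℓ) : Integrable (fun x => φ x • f x) (volume.restrict (Ioo 0 ℓ)) := by
  obtain ⟨C, hC⟩ := hφ.bounded_above_of_compact_support hc
  exact (L2.integrableOn f).bdd_smul C hφ.aestronglyMeasurable (Filter.Eventually.of_forall hC)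

lemma HasWeakDeriv.zero {ℓ : ℝ} : HasWeakDeriv (0 : L2 ℓ) 0 := by
  intro φ _ _ _
  have h0 : ((0 : L2 ℓ) : ℝ → ℂ) =ᵐ[volume.restrict (Ioo 0 ℓ)] 0 := Lp.coeFn_zero ..
  rw [integral_eq_zero_of_ae, integral_eq_zero_of_ae]
  · simp
  · filter_upwards [h0] with x hx; rw [hx]; simp
  · filter_upwards [h0] with x hx; rw [hx]; simp

lemma HasWeakDeriv.add {ℓ : ℝ} {f g f' g' : L2 ℓ} (h : HasWeakDeriv f g)
    (h' : HasWeakDeriv f' g') : HasWeakDeriv (f + f') (g + g') := by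
  intro φ h1 h2 h3
  have key : ∀ ψ : ℝ → ℝ, Continuous ψ → HasCompactSupport ψ → ∀ a b : L2 ℓ,
      ∫ x in Ioo 0 ℓ, ψ x • (a + b : L2 ℓ) x
        = (∫ x in Ioo 0 ℓ, ψ x • a x) + ∫ x in Ioo 0 ℓ, ψ x • b x := by
    intro ψ hψ hc a b
    rw [← integral_add (integrable_smul_test hψ hc a) (integrable_smul_test hψ hc b)]
    refine integral_congr_ae ?_
    filter_upwards [Lp.coeFn_add a b] with x hx
    rw [hx, Pi.add_apply, smul_add]
  rw [key _ (h1.continuous_deriv (by simp)) h2.deriv, key _ h1.continuous h2,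
    h φ h1 h2 h3, h' φ h1 h2 h3]
  ring

lemma HasWeakDeriv.smul {ℓ : ℝ} {f g : L2 ℓ} (c : ℂ) (h : HasWeakDeriv f g) :
    HasWeakDeriv (c • f) (c • g) := by
  intro φ h1 h2 h3
  have key : ∀ (ψ : ℝ → ℝ) (a : L2 ℓ),
      ∫ x in Ioo 0 ℓ, ψ x • (c • a : L2 ℓ) x = c • ∫ x in Ioo 0 ℓ, ψ x • a x := by
    intro ψ a
    rw [← integral_smul]
    refine integral_congr_ae ?_
    filter_upwards [Lp.coeFn_smul c a] with x hx
    rw [hx, Pi.smul_apply, smul_comm]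
  rw [key, key, h φ h1 h2 h3, smul_neg]

/-- The weak derivative is unique. -/
lemma HasWeakDeriv.unique {ℓ : ℝ} {f g g' : L2 ℓ} (h : HasWeakDeriv f g)
    (h' : HasWeakDeriv f g') : g = g' := by
  have hi := ((L2.integrableOn g).sub (L2.integrableOn g')).locallyIntegrableOn
  have := isOpen_Ioo.ae_eq_zero_of_integral_contDiff_smul_eq_zero hi (fun φ h1 h2 h3 => by
    have e : ∫ x, φ x • ((g : ℝ → ℂ) - g') x
        = ∫ x in Ioo 0 ℓ, φ x • ((g : ℝ → ℂ) - g') x := by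
      refine (setIntegral_eq_integral_of_forall_compl_eq_zero fun x hx => ?_).symm
      rw [image_eq_zero_of_notMem_tsupport (fun hx' => hx (h3 hx')), zero_smul]
    rw [e]
    simp only [Pi.sub_apply, smul_sub]
    rw [integral_sub (integrable_smul_test h1.continuous h2 g)
      (integrable_smul_test h1.continuous h2 g'), sub_eq_zero]
    have a := h φ h1 h2 h3
    rw [h' φ h1 h2 h3] at a
    exact (neg_injective a).symm)
  refine Lp.ext ?_
  rw [Filter.EventuallyEq, ae_restrict_iff' measurableSet_Ioo]
  filter_upwards [this] with x hx hm
  exact sub_eq_zero.mp (hx hm)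

/-- Integration by parts of a test function against an indefinite integral. -/
lemma integral_deriv_mul_primitive {ℓ : ℝ} (hℓ : 0 < ℓ) {g φ : ℝ → ℝ}
    (hg : IntegrableOn g (Ioo 0 ℓ)) (h1 : ContDiff ℝ ∞ φ) (h3 : tsupport φ ⊆ Ioo 0 ℓ) :
    ∫ x in Ioo 0 ℓ, deriv φ x * (∫ t in (0 : ℝ)..x, g t) = - ∫ x in Ioo 0 ℓ, φ x * g x := by
  have hgi : IntervalIntegrable g volume 0 ℓ := by
    rwa [intervalIntegrable_iff_integrableOn_Ioo_of_le hℓ.le]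
  have e0 : φ 0 = 0 := image_eq_zero_of_notMem_tsupport fun h => by simpa using h3 h
  have eℓ : φ ℓ = 0 := image_eq_zero_of_notMem_tsupport fun h => by simpa using h3 h
  have acφ : AbsolutelyContinuousOnInterval φ 0 ℓ :=
    (h1.of_le (by exact_mod_cast le_top)).contDiffOn.absolutelyContinuousOnInterval
  have acG : AbsolutelyContinuousOnInterval (fun x => ∫ t in (0 : ℝ)..x, g t) 0 ℓ :=
    hgi.absolutelyContinuousOnInterval_intervalIntegral (by simp)
  have ibp := acφ.integral_mul_deriv_eq_deriv_mul acG
  rw [e0, eℓ] at ibp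
  have hd : ∫ x in (0 : ℝ)..ℓ, φ x * deriv (fun x => ∫ t in (0 : ℝ)..x, g t) x
      = ∫ x in (0 : ℝ)..ℓ, φ x * g x := by
    refine intervalIntegral.integral_congr_ae ?_
    filter_upwards [hgi.ae_hasDerivAt_integral] with x hx hm
    rw [(hx (uIoc_subset_uIcc hm) 0 (by simp)).deriv]
  rw [hd] at ibp
  rw [← integral_Ioc_eq_integral_Ioo, ← integral_Ioc_eq_integral_Ioo,
    ← intervalIntegral.integral_of_le hℓ.le, ← intervalIntegral.integral_of_le hℓ.le, ibp]
  ring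

/-- The du Bois-Reymond lemma on `(0, ℓ)`, for real functions. -/
lemma ae_eq_primitive_real {ℓ : ℝ} (hℓ : 0 < ℓ) {f g : ℝ → ℝ}
    (hf : IntegrableOn f (Ioo 0 ℓ)) (hg : IntegrableOn g (Ioo 0 ℓ))
    (h : ∀ φ : ℝ → ℝ, ContDiff ℝ ∞ φ → HasCompactSupport φ → tsupport φ ⊆ Ioo 0 ℓ →
      ∫ x in Ioo 0 ℓ, deriv φ x * f x = - ∫ x in Ioo 0 ℓ, φ x * g x) :
    ∃ c : ℝ, ∀ᵐ x ∂(volume.restrict (Ioo 0 ℓ)), f x = c + ∫ t in (0 : ℝ)..x, g t := by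
  have hgi : IntervalIntegrable g volume 0 ℓ := by
    rwa [intervalIntegrable_iff_integrableOn_Ioo_of_le hℓ.le]
  set G : ℝ → ℝ := fun x => ∫ t in (0 : ℝ)..x, g t with hG
  have hGi : IntegrableOn G (Ioo 0 ℓ) := by
    have : ContinuousOn G (uIcc 0 ℓ) :=
      (hgi.absolutelyContinuousOnInterval_intervalIntegral (by simp)).continuousOn
    rw [uIcc_of_le hℓ.le] at this
    exact (this.integrableOn_Icc).mono_set Ioo_subset_Icc_self
  have hFi : IntegrableOn (fun x => f x - G x) (Ioo 0 ℓ) := hf.sub hGi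
  have bdd : ∀ ψ : ℝ → ℝ, Continuous ψ → HasCompactSupport ψ → ∀ a : ℝ → ℝ,
      IntegrableOn a (Ioo 0 ℓ) → IntegrableOn (fun x => ψ x * a x) (Ioo 0 ℓ) := by
    intro ψ hψ hc a ha
    obtain ⟨C, hC⟩ := hψ.bounded_above_of_compact_support hc
    exact ha.bdd_mul hψ.aestronglyMeasurable (Filter.Eventually.of_forall hC)
  have hF : ∀ φ : ℝ → ℝ, ContDiff ℝ ∞ φ → HasCompactSupport φ → tsupport φ ⊆ Ioo 0 ℓ →
      ∫ x in Ioo 0 ℓ, deriv φ x * (f x - G x) = 0 := by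
    intro φ h1 h2 h3
    have hd := h1.continuous_deriv (by simp)
    simp only [mul_sub]
    rw [integral_sub (bdd _ hd h2.deriv f hf) (bdd _ hd h2.deriv G hGi), h φ h1 h2 h3,
      integral_deriv_mul_primitive hℓ hg h1 h3, sub_self]
  -- a bump function of integral one
  let b₀ : ContDiffBump (ℓ / 2) :=
    { rIn := ℓ / 8, rOut := ℓ / 4, rIn_pos := by linarith, rIn_lt_rOut := by linarith }
  set ψ₀ : ℝ → ℝ := b₀.normed volume with hψ₀
  have hsm₀ : ContDiff ℝ ∞ ψ₀ := b₀.contDiff_normed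
  have hc₀ : HasCompactSupport ψ₀ := b₀.hasCompactSupport_normed
  have hs₀ : tsupport ψ₀ = Icc (ℓ / 4) (3 * ℓ / 4) := by
    rw [hψ₀, b₀.tsupport_normed_eq, Real.closedBall_eq_Icc]
    congr 1 <;> simp only [b₀] <;> ring
  have hone : ∫ x, ψ₀ x = 1 := b₀.integral_normed
  refine ⟨∫ x in Ioo 0 ℓ, ψ₀ x * (f x - G x), ?_⟩
  set c := ∫ x in Ioo 0 ℓ, ψ₀ x * (f x - G x) with hc
  have hci : IntegrableOn (fun x => (f x - G x) - c) (Ioo 0 ℓ) :=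
    hFi.sub (integrableOn_const (by simp))
  have main := isOpen_Ioo.ae_eq_zero_of_integral_contDiff_smul_eq_zero
    hci.locallyIntegrableOn (fun ψ h1 h2 h3 => by
    have e : ∫ x, ψ x • ((f x - G x) - c) = ∫ x in Ioo 0 ℓ, ψ x • ((f x - G x) - c) := by
      refine (setIntegral_eq_integral_of_forall_compl_eq_zero fun x hx => ?_).symm
      rw [image_eq_zero_of_notMem_tsupport (fun hx' => hx (h3 hx')), zero_smul]
    have e' : ∫ x in Ioo 0 ℓ, ψ x = ∫ x, ψ x := by
      refine setIntegral_eq_integral_of_forall_compl_eq_zero fun x hx => ?_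
      rw [image_eq_zero_of_notMem_tsupport (fun hx' => hx (h3 hx'))]
    set m := ∫ x, ψ x with hm
    set χ : ℝ → ℝ := fun x => ψ x - m * ψ₀ x with hχ
    have hχs : ContDiff ℝ ∞ χ := h1.sub (contDiff_const.mul hsm₀)
    have hχc : Continuous χ := hχs.continuous
    -- the supports lie in a compact subinterval
    set K := tsupport ψ ∪ tsupport ψ₀ with hK
    have hKc : IsCompact K := h2.isCompact.union hc₀.isCompact
    have hKn : K.Nonempty := ⟨ℓ / 2, Or.inr (by rw [hs₀]; constructor <;> linarith)⟩
    have hKs : K ⊆ Ioo 0 ℓ := by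
      refine union_subset h3 ?_
      rw [hs₀]
      exact Icc_subset_Ioo (by linarith) (by linarith)
    have ha := hKs (hKc.sInf_mem hKn)
    have hb := hKs (hKc.sSup_mem hKn)
    have hχ0 : ∀ x, x ∉ K → χ x = 0 := by
      intro x hx
      rw [hK, mem_union, not_or] at hx
      simp only [hχ]
      rw [image_eq_zero_of_notMem_tsupport hx.1, image_eq_zero_of_notMem_tsupport hx.2]
      ring
    have hχa : ∀ x, x < sInf K → χ x = 0 := fun x hx =>
      hχ0 x fun h => (not_le.mpr hx) (csInf_le hKc.bddBelow h)
    have hχb : ∀ x, sSup K < x → χ x = 0 := fun x hx =>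
      hχ0 x fun h => (not_le.mpr hx) (le_csSup hKc.bddAbove h)
    have hχi : ∫ x, χ x = 0 := by
      simp only [hχ]
      rw [integral_sub (h1.continuous.integrable_of_hasCompactSupport h2)
        ((hsm₀.continuous.integrable_of_hasCompactSupport hc₀).const_mul m),
        integral_const_mul, hone, ← hm]
      ring
    set Φ : ℝ → ℝ := fun x => ∫ t in (0 : ℝ)..x, χ t with hΦ
    have hΦd : ∀ x, HasDerivAt Φ (χ x) x := fun x => hχc.integral_hasStrictDerivAt 0 x |>.hasDerivAt
    have hΦd' : deriv Φ = χ := funext fun x => (hΦd x).deriv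
    have hΦs : ContDiff ℝ ∞ Φ := by
      rw [contDiff_infty_iff_deriv, hΦd']
      exact ⟨fun x => (hΦd x).differentiableAt, hχs⟩
    have hΦt : tsupport Φ ⊆ Icc (sInf K) (sSup K) := by
      refine closure_minimal (fun x hx => ?_) isClosed_Icc
      by_contra hn
      apply hx
      rw [mem_Icc, not_and_or, not_le, not_le] at hn
      rcases hn with hn | hn
      · simp only [hΦ]
        rw [intervalIntegral.integral_congr (g := fun _ => 0), intervalIntegral.integral_zero]
        intro t ht
        refine hχa t (lt_of_le_of_lt ht.2 (max_lt ha.1 hn))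
      · simp only [hΦ]
        rw [intervalIntegral.integral_of_le (hb.1.trans hn).le,
          setIntegral_eq_integral_of_forall_compl_eq_zero, hχi]
        intro t ht
        rw [mem_Ioc, not_and_or, not_lt, not_le] at ht
        rcases ht with ht | ht
        · exact hχa t (lt_of_le_of_lt ht ha.1)
        · exact hχb t (hn.trans ht)
    have z := hF Φ hΦs (HasCompactSupport.intro' isCompact_Icc isClosed_Icc
      fun x hx => image_eq_zero_of_notMem_tsupport fun h => hx (hΦt h))
      (hΦt.trans (Icc_subset_Ioo ha.1 hb.2))
    rw [hΦd'] at z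
    have z1 : ∫ x in Ioo 0 ℓ, χ x * (f x - G x)
        = (∫ x in Ioo 0 ℓ, ψ x * (f x - G x)) - m * c := by
      rw [hc, ← integral_const_mul, ← integral_sub (bdd _ h1.continuous h2 _ hFi)
        ((bdd _ hsm₀.continuous hc₀ _ hFi).const_mul m)]
      refine integral_congr_ae (Filter.Eventually.of_forall fun x => ?_)
      simp only [hχ]
      ring
    rw [e]
    simp only [smul_eq_mul, mul_sub _ _ c]
    rw [integral_sub (bdd _ h1.continuous h2 _ hFi)
      ((h1.continuous.integrable_of_hasCompactSupport h2).integrableOn.mul_const c),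
      integral_mul_const, e', ← z1, z])
  rw [ae_restrict_iff' measurableSet_Ioo]
  filter_upwards [main] with x hx hm
  have := hx hm
  linarith

/-- A function in `L²(0, ℓ)` with weak derivative `g` in `L²(0, ℓ)` agrees almost everywhere with
a primitive of `g`. -/
lemma HasWeakDeriv.ae_eq_primitive {ℓ : ℝ} {f g : L2 ℓ} (h : HasWeakDeriv f g) :
    ∃ c : ℂ, ∀ᵐ x ∂(volume.restrict (Ioo 0 ℓ)), f x = c + ∫ t in (0 : ℝ)..x, g t := by
  rcases le_or_gt ℓ 0 with hℓ | hℓ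
  · exact ⟨0, by simp [Ioo_eq_empty (not_lt.mpr hℓ)]⟩
  have hf := L2.integrableOn f
  have hg := L2.integrableOn g
  have hre : ∀ (ψ : ℝ → ℝ) (a : ℝ → ℂ), IntegrableOn (fun x => ψ x • a x) (Ioo 0 ℓ) →
      (∫ x in Ioo 0 ℓ, ψ x * (a x).re = (∫ x in Ioo 0 ℓ, ψ x • a x).re) ∧
      ∫ x in Ioo 0 ℓ, ψ x * (a x).im = (∫ x in Ioo 0 ℓ, ψ x • a x).im := by
    intro ψ a ha
    have e1 := integral_re (𝕜 := ℂ) ha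
    have e2 := integral_im (𝕜 := ℂ) ha
    simp only [RCLike.re_to_complex, RCLike.im_to_complex, Complex.smul_re, Complex.smul_im,
      smul_eq_mul] at e1 e2
    exact ⟨e1, e2⟩
  obtain ⟨c₁, h₁⟩ := ae_eq_primitive_real hℓ (f := fun x => (f x).re) (g := fun x => (g x).re)
    hf.re hg.re (fun φ a1 a2 a3 => by
      rw [(hre _ _ (integrable_smul_test (a1.continuous_deriv (by simp)) a2.deriv f)).1,
        (hre _ _ (integrable_smul_test a1.continuous a2 g)).1, h φ a1 a2 a3, Complex.neg_re])
  obtain ⟨c₂, h₂⟩ := ae_eq_primitive_real hℓ (f := fun x => (f x).im) (g := fun x => (g x).im)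
    hf.im hg.im (fun φ a1 a2 a3 => by
      rw [(hre _ _ (integrable_smul_test (a1.continuous_deriv (by simp)) a2.deriv f)).2,
        (hre _ _ (integrable_smul_test a1.continuous a2 g)).2, h φ a1 a2 a3, Complex.neg_im])
  refine ⟨⟨c₁, c₂⟩, ?_⟩
  filter_upwards [h₁, h₂, ae_restrict_mem measurableSet_Ioo] with x e₁ e₂ hx
  have hi : IntegrableOn g (Ioc 0 x) :=
    hg.mono_set fun t ht => ⟨ht.1, ht.2.trans_lt hx.2⟩
  have i1 := integral_re (𝕜 := ℂ) hi
  have i2 := integral_im (𝕜 := ℂ) hi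
  simp only [RCLike.re_to_complex, RCLike.im_to_complex] at i1 i2
  rw [intervalIntegral.integral_of_le hx.1.le] at e₁ e₂ ⊢
  apply Complex.ext
  · rw [e₁, Complex.add_re, i1]
  · rw [e₂, Complex.add_im, i2]

/-- The Sobolev space `H¹(0, ℓ)`, as the space of pairs `(u, u')`; the topology inherited from
`L² × L²` is that of the `H¹` norm. -/
def H1 (ℓ : ℝ) : Submodule ℂ (L2 ℓ × L2 ℓ) where
  carrier := {u | HasWeakDeriv u.1 u.2}
  add_mem' h h' := h.add h'
  zero_mem' := HasWeakDeriv.zero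
  smul_mem' c _ h := h.smul c

/-- The Sobolev space `H²(0, ℓ)`, as the space of triples `(u, u', u'')`. -/
def H2 (ℓ : ℝ) : Submodule ℂ (L2 ℓ × L2 ℓ × L2 ℓ) where
  carrier := {u | HasWeakDeriv u.1 u.2.1 ∧ HasWeakDeriv u.2.1 u.2.2}
  add_mem' h h' := ⟨h.1.add h'.1, h.2.add h'.2⟩
  zero_mem' := ⟨HasWeakDeriv.zero, HasWeakDeriv.zero⟩
  smul_mem' c _ h := ⟨h.1.smul c, h.2.smul c⟩

/-- The inclusion `H²(0, ℓ) ⊆ H¹(0, ℓ)`, `u ↦ u`. -/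
def H2.toH1 {ℓ : ℝ} : H2 ℓ →ₗ[ℂ] H1 ℓ where
  toFun u := ⟨(u.1.1, u.1.2.1), u.2.1⟩
  map_add' _ _ := rfl
  map_smul' _ _ := rfl

/-- The derivative `H²(0, ℓ) → H¹(0, ℓ)`, `u ↦ u'`. -/
def H2.deriv {ℓ : ℝ} : H2 ℓ →ₗ[ℂ] H1 ℓ where
  toFun u := ⟨(u.1.2.1, u.1.2.2), u.2.2⟩
  map_add' _ _ := rfl
  map_smul' _ _ := rfl

lemma H1.exists_rep {ℓ : ℝ} (u : H1 ℓ) :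
    ∃ F : ℝ → ℂ, ContinuousOn F (Icc 0 ℓ) ∧ F =ᵐ[volume.restrict (Ioo 0 ℓ)] u.1.1 := by
  obtain ⟨c, hc⟩ := HasWeakDeriv.ae_eq_primitive u.2
  rcases le_or_gt ℓ 0 with hℓ | hℓ
  · exact ⟨0, continuousOn_const, by
      have h0 : volume.restrict (Ioo 0 ℓ) = 0 := by rw [Ioo_eq_empty (not_lt.mpr hℓ)]; simp
      have h1 (P : ℝ → Prop) : ∀ᵐ x ∂(volume.restrict (Ioo 0 ℓ)), P x := by simp [h0]
      exact h1 _⟩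
  refine ⟨fun x => c + ∫ t in (0 : ℝ)..x, u.1.2 t, ?_, ?_⟩
  · refine continuousOn_const.add ?_
    have := intervalIntegral.continuousOn_primitive_interval (μ := volume) (a := 0) (b := ℓ)
      (f := u.1.2) (by
        rw [uIcc_of_le hℓ.le, integrableOn_Icc_iff_integrableOn_Ioo]
        exact L2.integrableOn _)
    rwa [uIcc_of_le hℓ.le] at this
  · filter_upwards [hc] with x hx using hx.symm

/-- The continuous representative on `[0, ℓ]` of an element of `H¹(0, ℓ)`. -/
def H1.rep {ℓ : ℝ} (u : H1 ℓ) : ℝ → ℂ := (H1.exists_rep u).choose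

lemma H1.continuousOn_rep {ℓ : ℝ} (u : H1 ℓ) : ContinuousOn (H1.rep u) (Icc 0 ℓ) :=
  (H1.exists_rep u).choose_spec.1

lemma H1.rep_ae_eq {ℓ : ℝ} (u : H1 ℓ) : (H1.rep u) =ᵐ[volume.restrict (Ioo 0 ℓ)] u.1.1 :=
  (H1.exists_rep u).choose_spec.2

lemma H1.rep_unique {ℓ : ℝ} (hℓ : 0 < ℓ) (u : H1 ℓ) {F : ℝ → ℂ} (hF : ContinuousOn F (Icc 0 ℓ))
    (h : F =ᵐ[volume.restrict (Ioo 0 ℓ)] u.1.1) : EqOn (H1.rep u) F (Icc 0 ℓ) := by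
  refine Measure.eqOn_Icc_of_ae_eq volume hℓ.ne ?_ (H1.continuousOn_rep u) hF
  rw [← restrict_Ioo_eq_restrict_Icc]
  exact (H1.rep_ae_eq u).trans h.symm

/-- The value `u(x)` at a point `x` of `[0, ℓ]`, as a linear form on `H¹(0, ℓ)`. -/
def H1.eval {ℓ : ℝ} (hℓ : 0 < ℓ) (x : Icc 0 ℓ) : H1 ℓ →ₗ[ℂ] ℂ where
  toFun u := (H1.rep u) x
  map_add' u w := by
    refine H1.rep_unique hℓ (u + w) ((H1.continuousOn_rep u).add (H1.continuousOn_rep w)) ?_ x.2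
    filter_upwards [(H1.rep_ae_eq u), (H1.rep_ae_eq w), Lp.coeFn_add u.1.1 w.1.1] with y h1 h2 h3
    change (H1.rep u) y + (H1.rep w) y = (u.1.1 + w.1.1 : L2 ℓ) y
    rw [h3, h1, h2, Pi.add_apply]
  map_smul' c u := by
    refine H1.rep_unique hℓ (c • u) ((H1.continuousOn_rep u).const_smul c) ?_ x.2
    filter_upwards [(H1.rep_ae_eq u), Lp.coeFn_smul c u.1.1] with y h1 h2
    change c • (H1.rep u) y = (c • u.1.1 : L2 ℓ) y
    rw [h2, h1, Pi.smul_apply]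

/-! ## Metric trees -/

/-- A rooted metric tree with vertex set `V` and edge set `E`: a finite combinatorial tree whose
edge `j` is identified with the interval `[0, len j]`, the point `0` being the vertex `init j` and
the point `len j` the vertex `term j` (the orientation of the edges is arbitrary).
The root is an exterior vertex, i.e. it lies on exactly one edge. -/
structure MetricTree (V E : Type*) where
  init : E → V
  term : E → V
  init_ne_term : ∀ j, init j ≠ term j
  edge_injective : Function.Injective fun j => s(init j, term j)
  isTree : (SimpleGraph.fromEdgeSet (range fun j => s(init j, term j))).IsTree
  len : E → ℝ
  len_pos : ∀ j, 0 < len j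
  root : V
  root_exterior : ∃! j, init j = root ∨ term j = root

namespace MetricTree

variable {V E : Type*} [Fintype E] (T : MetricTree V E)

open Classical in
/-- The set `J_k` of the edges adjacent to the vertex `k`. -/
def adj (k : V) : Finset E := Finset.univ.filter fun j => T.init j = k ∨ T.term j = k

/-- An interior vertex: a vertex lying on more than one edge (hence not the root). -/
def IsInterior (k : V) : Prop := 1 < (T.adj k).card

/-- A leaf: an exterior vertex different from the root. -/
def IsLeaf (k : V) : Prop := (T.adj k).card = 1 ∧ k ≠ T.root

/-- The index type of the interior vertices. -/
abbrev Interior : Type _ := {k : V // T.IsInterior k}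

open Classical in
/-- The incidence matrix. -/
def inc (k : V) (j : E) : ℂ := if T.term j = k then 1 else if T.init j = k then -1 else 0

open Classical in
/-- The parameter in `[0, len j]` of the vertex `k`, for an edge `j` adjacent to `k`. -/
def pos (k : V) (j : E) : Icc 0 (T.len j) :=
  if T.term j = k then ⟨T.len j, (T.len_pos j).le, le_rfl⟩ else ⟨0, le_rfl, (T.len_pos j).le⟩

/-- The value `u(a_k)` of a function `u ∈ H¹` on the edge `j` at the vertex `k`, for an edge `j`
adjacent to `k`. -/
def trace (k : V) (j : E) : H1 (T.len j) →ₗ[ℂ] ℂ := H1.eval (T.len_pos j) (T.pos k j)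

/-- The space `V` of the functions on the tree which are `H¹` on each edge, vanish at the root, and
are continuous at the interior vertices. -/
def VSpace : Submodule ℂ (∀ j, H1 (T.len j)) where
  carrier := {u | (∀ j ∈ T.adj T.root, T.trace T.root j (u j) = 0) ∧
    ∀ k, T.IsInterior k → ∀ i ∈ T.adj k, ∀ j ∈ T.adj k, T.trace k i (u i) = T.trace k j (u j)}
  add_mem' {u w} h h' := by
    refine ⟨fun j hj => ?_, fun k hk i hi j hj => ?_⟩
    · rw [Pi.add_apply, map_add, h.1 j hj, h'.1 j hj, add_zero]
    · rw [Pi.add_apply, Pi.add_apply, map_add, map_add, h.2 k hk i hi j hj, h'.2 k hk i hi j hj]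
  zero_mem' := by simp
  smul_mem' c u h := by
    refine ⟨fun j hj => ?_, fun k hk i hi j hj => ?_⟩
    · rw [Pi.smul_apply, map_smul, h.1 j hj, smul_zero]
    · rw [Pi.smul_apply, Pi.smul_apply, map_smul, map_smul, h.2 k hk i hi j hj]

/-- The state space `H = V × ∏ L²(0, ℓ_j) × ℂ^M × ℂ^M` of the states `(y, v, p, q)`, with the
product topology, which is the topology of the usual Hilbert norm on this product. -/
abbrev State : Type _ :=
  T.VSpace × (∀ j, L2 (T.len j)) × (T.Interior → ℂ) × (T.Interior → ℂ)

lemma adj_nonempty (k : T.Interior) : (T.adj k.1).Nonempty :=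
  Finset.card_pos.mp (lt_trans Nat.zero_lt_one k.2)

/-- The value `u(a_k)` of `u ∈ V` at an interior vertex `k`; it may be read off on any edge
adjacent to `k`. -/
def nodeValue (k : T.Interior) : T.VSpace →ₗ[ℂ] ℂ :=
  T.trace k.1 (T.adj_nonempty k).choose ∘ₗ LinearMap.proj (T.adj_nonempty k).choose ∘ₗ
    T.VSpace.subtype

/-- The outer derivative `d_{kj} (y^j)'(a_k)` of a function `y^j ∈ H²` on the edge `j` at the
vertex `k`, for an edge `j` adjacent to `k`. -/
def slope (k : V) (j : E) : H2 (T.len j) →ₗ[ℂ] ℂ := T.inc k j • (T.trace k j ∘ₗ H2.deriv)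

/-- The inclusion `∏ H²(0, ℓ_j) ⊆ ∏ H¹(0, ℓ_j)`. -/
def toH1 : (∀ j, H2 (T.len j)) →ₗ[ℂ] ∀ j, H1 (T.len j) :=
  LinearMap.pi fun j => H2.toH1 ∘ₗ LinearMap.proj j

/-- The total outer flux `∑_{j ∈ J_k} d_{kj} (y^j)'(a_k)` at the vertex `k`. -/
def flux (k : V) : (∀ j, H2 (T.len j)) →ₗ[ℂ] ℂ :=
  ∑ j ∈ T.adj k, T.slope k j ∘ₗ LinearMap.proj j

/-- The domain `D(A)`: the `(y, v, p, q)` in `[∏ H²(0, ℓ_j) ∩ V] × V × ℂ^M × ℂ^M` such that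
`∑_{j ∈ J_k} d_{kj} (y^j)'(a_k) = q_k` at the interior vertices and
`d_{kj} (y^j)'(a_k) = - v^j(a_k)` at the leaves. -/
def Domain : Submodule ℂ
    ((∀ j, H2 (T.len j)) × T.VSpace × (T.Interior → ℂ) × (T.Interior → ℂ)) where
  carrier := {z | T.toH1 z.1 ∈ T.VSpace ∧
    (∀ k : T.Interior, T.flux k.1 z.1 = z.2.2.2 k) ∧
    ∀ k, T.IsLeaf k → ∀ j ∈ T.adj k, T.slope k j (z.1 j) = - T.trace k j (z.2.1.1 j)}
  add_mem' {z z'} h h' := by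
    refine ⟨?_, fun k => ?_, fun k hk j hj => ?_⟩
    · rw [Prod.fst_add, map_add]
      exact T.VSpace.add_mem h.1 h'.1
    · rw [Prod.fst_add, map_add, h.2.1 k, h'.2.1 k]
      rfl
    · rw [Prod.fst_add, Prod.snd_add, Prod.fst_add, Pi.add_apply, Submodule.coe_add, Pi.add_apply,
        map_add, map_add, neg_add, h.2.2 k hk j hj, h'.2.2 k hk j hj]
  zero_mem' := by
    refine ⟨?_, fun k => ?_, fun k hk j hj => ?_⟩
    · rw [Prod.fst_zero, map_zero]
      exact T.VSpace.zero_mem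
    · rw [Prod.fst_zero, map_zero]
      rfl
    · rw [Prod.fst_zero, Prod.snd_zero, Prod.fst_zero, Pi.zero_apply, Submodule.coe_zero,
        Pi.zero_apply, map_zero, map_zero, neg_zero]
  smul_mem' c z h := by
    refine ⟨?_, fun k => ?_, fun k hk j hj => ?_⟩
    · rw [Prod.smul_fst, map_smul]
      exact T.VSpace.smul_mem c h.1
    · rw [Prod.smul_fst, map_smul, h.2.1 k]
      rfl
    · rw [Prod.smul_fst, Prod.smul_snd, Prod.smul_fst, Pi.smul_apply, Submodule.coe_smul,
        Pi.smul_apply, map_smul, map_smul, ← smul_neg, h.2.2 k hk j hj]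

/-- The inclusion `D(A) ⊆ H`. -/
def incl : T.Domain →ₗ[ℂ] T.State where
  toFun z := (⟨T.toH1 z.1.1, z.2.1⟩, fun j => (z.1.2.1.1 j).1.1,
    z.1.2.2.1, z.1.2.2.2)
  map_add' _ _ := rfl
  map_smul' _ _ := rfl

lemma incl_injective : Function.Injective T.incl := by
  rintro ⟨⟨y, v, p, q⟩, hz⟩ ⟨⟨y', v', p', q'⟩, hz'⟩ h
  have hy : T.toH1 y = T.toH1 y' :=
    congrArg (fun s : T.State => s.1.1) h
  have hv : (fun j => (v.1 j).1.1) = fun j => (v'.1 j).1.1 :=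
    congrArg (fun s : T.State => s.2.1) h
  obtain rfl : p = p' := congrArg (fun s : T.State => s.2.2.1) h
  obtain rfl : q = q' := congrArg (fun s : T.State => s.2.2.2) h
  have ey : y = y' := by
    funext j
    have e : H2.toH1 (y j) = H2.toH1 (y' j) := congrFun hy j
    have e1 : (y j).1.1 = (y' j).1.1 := congrArg (fun u => u.1.1) e
    have e2 : (y j).1.2.1 = (y' j).1.2.1 := congrArg (fun u => u.1.2) e
    have a := (y j).2.2
    have b := (y' j).2.2
    rw [← e2] at b
    exact Subtype.ext (Prod.ext e1 (Prod.ext e2 (a.unique b)))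
  have ev : v = v' := by
    refine Subtype.ext (funext fun j => ?_)
    have e : (v.1 j).1.1 = (v'.1 j).1.1 := congrFun hv j
    have a := (v.1 j).2
    have b : HasWeakDeriv (v'.1 j).1.1 (v'.1 j).1.2 := (v'.1 j).2
    rw [← e] at b
    exact Subtype.ext (Prod.ext e (HasWeakDeriv.unique a b))
  subst ey ev
  rfl

/-- The map `(y, v, p, q) ↦ (v, y'', q, -p - v_M)` on `D(A)`. -/
def generatorMap : T.Domain →ₗ[ℂ] T.State where
  toFun z := (z.1.2.1, fun j => (z.1.1 j).1.2.2, z.1.2.2.2,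
    fun k => - z.1.2.2.1 k - T.nodeValue k z.1.2.1)
  map_add' z w := by
    refine Prod.ext rfl (Prod.ext rfl (Prod.ext rfl (funext fun k => ?_)))
    simp only [Submodule.coe_add, Prod.snd_add, Prod.fst_add, Pi.add_apply, map_add]
    ring
  map_smul' c z := by
    refine Prod.ext rfl (Prod.ext rfl (Prod.ext rfl (funext fun k => ?_)))
    simp only [Submodule.coe_smul, Prod.smul_snd, Prod.smul_fst, Pi.smul_apply, map_smul,
      smul_eq_mul, RingHom.id_apply]
    ring

/-- The generator `A`, an unbounded operator on `H` with domain `D(A)`. -/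
def generator : T.State →ₗ.[ℂ] T.State where
  domain := LinearMap.range T.incl
  toFun := T.generatorMap ∘ₗ (LinearEquiv.ofInjective T.incl T.incl_injective).symm.toLinearMap

/-- A Pi-tree: no edge has a length `mπ` with `m ∈ ℕ*`, except maybe those attached to leaves. -/
def IsPiTree : Prop :=
  ∀ j, ¬ T.IsLeaf (T.init j) → ¬ T.IsLeaf (T.term j) → ∀ m : ℕ, 1 ≤ m → T.len j ≠ m * Real.pi

end MetricTree

/-! ## Spectrum of an unbounded operator -/

/-- The resolvent set of an unbounded operator `A`: the `μ` for which `μ - A` is a bijection of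
`D(A)` onto `X` with a continuous inverse `R`. -/
def resolventSet {X : Type*} [AddCommGroup X] [Module ℂ X] [TopologicalSpace X]
    (A : X →ₗ.[ℂ] X) : Set ℂ :=
  {μ | ∃ R : X →L[ℂ] X,
    (∀ x, ∃ h : R x ∈ A.domain, μ • R x - A ⟨R x, h⟩ = x) ∧
    ∀ z : A.domain, R (μ • (z : X) - A z) = z}

/-- The spectrum of an unbounded operator: the complement of its resolvent set. -/
def spectrum {X : Type*} [AddCommGroup X] [Module ℂ X] [TopologicalSpace X]
    (A : X →ₗ.[ℂ] X) : Set ℂ :=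
  (resolventSet A)ᶜ

end FluidTree

end

noncomputable section

namespace FluidTree

/-! ## Analysis on a single edge -/

/-! On the imaginary axis the spectrum consists of eigenvalues, and these can be found by hand.

Reduction to eigenvalues. In the resolvent equation `v` and `q` can be eliminated, which leaves `y''
= λ² y + g` on each edge together with vertex conditions. The solutions on an edge are determined by
two Cauchy data, so the unknowns (two per edge, and `p`) are as many as the equations (one per
half-edge, one per interior vertex). Injectivity therefore gives surjectivity
(`exists_boundary_solution`), and the bounded inverse theorem makes the inverse continuous
(`mem_resolventSet_of_bijective`). It remains to study the homogeneous solutions, the modes of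
`IsMode`.

Pi-trees have no modes for `λ = iβ`. If `β ≠ 0`, then `Im (y' ȳ)` is constant on each edge, so its
outer values sum to zero over all half-edges. The root and the interior vertices contribute nothing
and a leaf contributes `-β |y|²`; hence `y` and its slope vanish at the leaves, and `y = 0` on leaf
edges (`leaf_eq_zero`). If `β² ≠ 1`, any remaining nonzero edges can be peeled off: some vertex
other than the root meets exactly one of them, and there its Cauchy data vanish. If `β² = 1`, the
node equation forces `y = 0` at every interior vertex, so each inner edge carries a Dirichlet
solution of `y'' = -y`, which is zero unless the length is some `mπ`. If `β = 0`, peeling kills the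
constant slopes, and the zero value at the root spreads over the tree.

Conversely, an inner edge of length `mπ` carries a sine that vanishes at both ends. Extended by zero
it is an eigenfunction for `i`: since `λ² + 1 = 0`, the node equation leaves `p` free to absorb the
fluxes (`I_mem_spectrum`). -/

lemma H1.ext_fst {ℓ : ℝ} {u w : H1 ℓ} (h : u.1.1 = w.1.1) : u = w := by
  have a : HasWeakDeriv u.1.1 u.1.2 := u.2
  have b : HasWeakDeriv w.1.1 w.1.2 := w.2
  rw [← h] at b
  exact Subtype.ext (Prod.ext h (a.unique b))

lemma L2.intervalIntegrable {ℓ x : ℝ} (hx : x ∈ Icc 0 ℓ) (g : L2 ℓ) :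
    IntervalIntegrable g volume 0 x := by
  rw [intervalIntegrable_iff_integrableOn_Ioo_of_le hx.1]
  exact (L2.integrableOn g).mono_set (Ioo_subset_Ioo_right hx.2)

lemma L2.continuousOn_primitive {ℓ : ℝ} (hℓ : 0 < ℓ) (c : ℂ) (g : L2 ℓ) :
    ContinuousOn (fun x => c + ∫ t in (0 : ℝ)..x, g t) (Icc 0 ℓ) := by
  refine continuousOn_const.add ?_
  have := intervalIntegral.continuousOn_primitive_interval (μ := volume) (a := 0) (b := ℓ)
    (f := g) (by
      rw [uIcc_of_le hℓ.le, integrableOn_Icc_iff_integrableOn_Ioo]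
      exact L2.integrableOn _)
  rwa [uIcc_of_le hℓ.le] at this

/-- The fundamental theorem of calculus in `H¹(0, ℓ)`. -/
lemma H1.rep_eq_primitive {ℓ : ℝ} (hℓ : 0 < ℓ) (u : H1 ℓ) {x : ℝ} (hx : x ∈ Icc 0 ℓ) :
    H1.rep u x = H1.rep u 0 + ∫ t in (0 : ℝ)..x, u.1.2 t := by
  obtain ⟨c, hc⟩ := HasWeakDeriv.ae_eq_primitive u.2
  have h := H1.rep_unique hℓ u (L2.continuousOn_primitive hℓ c u.1.2) (by
    filter_upwards [hc] with x hx using hx.symm)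
  have h0 := h (left_mem_Icc.2 hℓ.le)
  simp only [intervalIntegral.integral_same, add_zero] at h0
  rw [h hx, h0]

/-- Real and imaginary parts of `φ` are themselves admissible test functions. Complex tests are
needed in the product rule with complex exponentials. -/
lemma HasWeakDeriv.complex_test {ℓ : ℝ} {f g : L2 ℓ} (h : HasWeakDeriv f g) {φ : ℝ → ℂ}
    (h1 : ContDiff ℝ ∞ φ) (h2 : HasCompactSupport φ) (h3 : tsupport φ ⊆ Ioo 0 ℓ) :
    ∫ x in Ioo 0 ℓ, deriv φ x * f x = - ∫ x in Ioo 0 ℓ, φ x * g x := by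
  have hd : ∀ x, DifferentiableAt ℝ φ x := fun x => (h1.differentiable (by simp)) x
  have hre : ∀ x, deriv (fun x => (φ x).re) x = (deriv φ x).re := fun x =>
    (Complex.reCLM.hasFDerivAt.comp_hasDerivAt x (hd x).hasDerivAt).deriv
  have him : ∀ x, deriv (fun x => (φ x).im) x = (deriv φ x).im := fun x =>
    (Complex.imCLM.hasFDerivAt.comp_hasDerivAt x (hd x).hasDerivAt).deriv
  have s1 : ContDiff ℝ ∞ (fun x => (φ x).re) := Complex.reCLM.contDiff.comp h1
  have s2 : ContDiff ℝ ∞ (fun x => (φ x).im) := Complex.imCLM.contDiff.comp h1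
  have c1 : HasCompactSupport (fun x => (φ x).re) := h2.comp_left (g := Complex.re) rfl
  have c2 : HasCompactSupport (fun x => (φ x).im) := h2.comp_left (g := Complex.im) rfl
  have t1 : tsupport (fun x => (φ x).re) ⊆ Ioo 0 ℓ :=
    (closure_mono (Function.support_comp_subset (g := Complex.re) rfl φ)).trans h3
  have t2 : tsupport (fun x => (φ x).im) ⊆ Ioo 0 ℓ :=
    (closure_mono (Function.support_comp_subset (g := Complex.im) rfl φ)).trans h3
  have key : ∀ (α β : ℝ → ℝ) (e : L2 ℓ), Continuous α → HasCompactSupport α → Continuous β →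
      HasCompactSupport β → ∀ γ : ℝ → ℂ, (∀ x, γ x = α x + β x * Complex.I) →
      ∫ x in Ioo 0 ℓ, γ x * e x
        = (∫ x in Ioo 0 ℓ, α x • e x) + Complex.I * ∫ x in Ioo 0 ℓ, β x • e x := by
    intro α β e a1 a2 b1 b2 γ hγ
    rw [← integral_const_mul, ← integral_add (integrable_smul_test a1 a2 e)
      ((integrable_smul_test b1 b2 e).const_mul _)]
    refine integral_congr_ae (Filter.Eventually.of_forall fun x => ?_)
    simp only [hγ, Complex.real_smul]
    ring
  rw [key _ _ f (s1.continuous_deriv (by simp)) c1.deriv (s2.continuous_deriv (by simp)) c2.deriv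
      _ (fun x => by rw [hre, him, Complex.re_add_im]),
    key _ _ g s1.continuous c1 s2.continuous c2 _ (fun x => (Complex.re_add_im _).symm),
    h _ s1 c1 t1, h _ s2 c2 t2]
  ring

/-- Converse of the du Bois-Reymond lemma: integrate by parts in real and imaginary parts; the
constant drops out because `φ` vanishes at both ends. -/
lemma L2.hasWeakDeriv_primitive {ℓ : ℝ} (hℓ : 0 < ℓ) {f g : L2 ℓ} {c : ℂ}
    (hf : ∀ᵐ x ∂(volume.restrict (Ioo 0 ℓ)), f x = c + ∫ t in (0 : ℝ)..x, g t) :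
    HasWeakDeriv f g := by
  intro φ h1 h2 h3
  have hg := L2.integrableOn g
  have hre : ∀ (ψ : ℝ → ℝ) (a : ℝ → ℂ), IntegrableOn (fun x => ψ x • a x) (Ioo 0 ℓ) →
      (∫ x in Ioo 0 ℓ, ψ x * (a x).re = (∫ x in Ioo 0 ℓ, ψ x • a x).re) ∧
      ∫ x in Ioo 0 ℓ, ψ x * (a x).im = (∫ x in Ioo 0 ℓ, ψ x • a x).im := by
    intro ψ a ha
    have e1 := integral_re (𝕜 := ℂ) ha
    have e2 := integral_im (𝕜 := ℂ) ha
    simp only [RCLike.re_to_complex, RCLike.im_to_complex, Complex.smul_re, Complex.smul_im,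
      smul_eq_mul] at e1 e2
    exact ⟨e1, e2⟩
  have e0 : φ 0 = 0 := image_eq_zero_of_notMem_tsupport fun h => by simpa using h3 h
  have eℓ : φ ℓ = 0 := image_eq_zero_of_notMem_tsupport fun h => by simpa using h3 h
  have hdc := h1.continuous_deriv (by simp)
  have hconst : ∫ x in Ioo 0 ℓ, deriv φ x = 0 := by
    rw [← integral_Ioc_eq_integral_Ioo, ← intervalIntegral.integral_of_le hℓ.le,
      intervalIntegral.integral_deriv_eq_sub (fun x _ => h1.differentiable (by simp) x)
        (hdc.intervalIntegrable _ _), e0, eℓ, sub_zero]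
  have hdi : IntegrableOn (deriv φ) (Ioo 0 ℓ) :=
    (hdc.integrable_of_hasCompactSupport h2.deriv).integrableOn
  have bdd : ∀ a : ℝ → ℝ, IntegrableOn a (Ioo 0 ℓ) →
      IntegrableOn (fun x => deriv φ x * a x) (Ioo 0 ℓ) := by
    intro a ha
    obtain ⟨C, hC⟩ := hdc.bounded_above_of_compact_support h2.deriv
    exact ha.bdd_mul hdc.aestronglyMeasurable (Filter.Eventually.of_forall hC)
  have real_part : ∀ (F G : ℝ → ℝ) (k : ℝ), IntegrableOn G (Ioo 0 ℓ) →
      (∀ᵐ x ∂(volume.restrict (Ioo 0 ℓ)), F x = k + ∫ t in (0 : ℝ)..x, G t) →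
      ∫ x in Ioo 0 ℓ, deriv φ x * F x = - ∫ x in Ioo 0 ℓ, φ x * G x := by
    intro F G k hG hF
    rw [← integral_deriv_mul_primitive hℓ hG h1 h3]
    have hP : IntegrableOn (fun x => ∫ t in (0 : ℝ)..x, G t) (Ioo 0 ℓ) := by
      have := intervalIntegral.continuousOn_primitive_interval (μ := volume) (a := 0) (b := ℓ)
        (f := G) (by rwa [uIcc_of_le hℓ.le, integrableOn_Icc_iff_integrableOn_Ioo])
      rw [uIcc_of_le hℓ.le] at this
      exact this.integrableOn_Icc.mono_set Ioo_subset_Icc_self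
    have : ∫ x in Ioo 0 ℓ, deriv φ x * F x
        = ∫ x in Ioo 0 ℓ, (deriv φ x * k + deriv φ x * ∫ t in (0 : ℝ)..x, G t) := by
      refine integral_congr_ae ?_
      filter_upwards [hF] with x hx
      rw [hx, mul_add]
    rw [this, integral_add (hdi.mul_const k) (bdd _ hP), integral_mul_const, hconst, zero_mul,
      zero_add]
  have hpart : ∀ᵐ x ∂(volume.restrict (Ioo 0 ℓ)),
      (f x).re = c.re + (∫ t in (0 : ℝ)..x, (g t).re) ∧
      (f x).im = c.im + (∫ t in (0 : ℝ)..x, (g t).im) := by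
    filter_upwards [hf, ae_restrict_mem measurableSet_Ioo] with x e hx
    have hi : IntegrableOn g (Ioc 0 x) := hg.mono_set fun t ht => ⟨ht.1, ht.2.trans_lt hx.2⟩
    have i1 := integral_re (𝕜 := ℂ) hi
    have i2 := integral_im (𝕜 := ℂ) hi
    simp only [RCLike.re_to_complex, RCLike.im_to_complex] at i1 i2
    simp only [intervalIntegral.integral_of_le hx.1.le] at e ⊢
    rw [e, Complex.add_re, Complex.add_im, i1, i2]
    exact ⟨rfl, rfl⟩
  have p1 := real_part _ _ _ hg.re (hpart.mono fun x h => h.1)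
  have p2 := real_part _ _ _ hg.im (hpart.mono fun x h => h.2)
  have q1 := hre _ _ (integrable_smul_test hdc h2.deriv f)
  have q2 := hre _ _ (integrable_smul_test h1.continuous h2 g)
  apply Complex.ext
  · rw [← q1.1, Complex.neg_re, ← q2.1]; exact p1
  · rw [← q1.2, Complex.neg_im, ← q2.2]; exact p2

lemma L2.exists_of_continuousOn {ℓ : ℝ} {F : ℝ → ℂ} (hF : ContinuousOn F (Icc 0 ℓ)) :
    ∃ f : L2 ℓ, f =ᵐ[volume.restrict (Ioo 0 ℓ)] F := by
  have h : MemLp F 2 (volume.restrict (Ioo 0 ℓ)) := by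
    obtain ⟨C, hC⟩ := isCompact_Icc.exists_bound_of_continuousOn hF
    refine MemLp.of_bound ((hF.mono Ioo_subset_Icc_self).aestronglyMeasurable measurableSet_Ioo) C ?_
    filter_upwards [ae_restrict_mem measurableSet_Ioo] with x hx
    exact hC x (Ioo_subset_Icc_self hx)
  exact ⟨h.toLp F, h.coeFn_toLp⟩

/-- Every `g ∈ L²(0, ℓ)` has a primitive in `H¹(0, ℓ)` with a prescribed value at `0`. -/
lemma H1.exists_primitive {ℓ : ℝ} (hℓ : 0 < ℓ) (g : L2 ℓ) (c : ℂ) :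
    ∃ u : H1 ℓ, u.1.2 = g ∧ H1.rep u 0 = c := by
  have hc := L2.continuousOn_primitive hℓ c g
  obtain ⟨f, hf⟩ := L2.exists_of_continuousOn hc
  refine ⟨⟨(f, g), L2.hasWeakDeriv_primitive hℓ (c := c) hf⟩, rfl, ?_⟩
  rw [H1.rep_unique hℓ ⟨(f, g), L2.hasWeakDeriv_primitive hℓ (c := c) hf⟩ hc hf.symm
    (left_mem_Icc.2 hℓ.le)]
  simp

lemma L2.exists_mul {ℓ : ℝ} {φ : ℝ → ℂ} (hφ : Continuous φ) (f : L2 ℓ) :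
    ∃ g : L2 ℓ, g =ᵐ[volume.restrict (Ioo 0 ℓ)] fun x => φ x * f x := by
  have h : MemLp (fun x => φ x * f x) 2 (volume.restrict (Ioo 0 ℓ)) := by
    obtain ⟨C, hC⟩ := (isCompact_Icc (a := (0 : ℝ)) (b := ℓ)).exists_bound_of_continuousOn
      hφ.continuousOn
    refine (Lp.memLp f).of_le_mul (c := C)
      (hφ.aestronglyMeasurable.mul (Lp.memLp f).aestronglyMeasurable) ?_
    filter_upwards [ae_restrict_mem measurableSet_Ioo] with x hx
    rw [norm_mul]
    gcongr
    exact hC x (Ioo_subset_Icc_self hx)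
  exact ⟨h.toLp _, h.coeFn_toLp⟩

/-- The product rule. -/
lemma HasWeakDeriv.mul {ℓ : ℝ} {f g F G : L2 ℓ} (h : HasWeakDeriv f g) {η : ℝ → ℂ}
    (hη : ContDiff ℝ ∞ η) (hF : F =ᵐ[volume.restrict (Ioo 0 ℓ)] fun x => η x * f x)
    (hG : G =ᵐ[volume.restrict (Ioo 0 ℓ)] fun x => deriv η x * f x + η x * g x) :
    HasWeakDeriv F G := by
  intro φ h1 h2 h3
  have hηd : ∀ x, HasDerivAt η (deriv η x) x :=
    fun x => ((hη.differentiable (by simp)) x).hasDerivAt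
  have hφd : ∀ x, HasDerivAt φ (deriv φ x) x :=
    fun x => ((h1.differentiable (by simp)) x).hasDerivAt
  -- Testing the weak derivative of `f` against `φ η` and expanding `(φ η)'` gives the product rule.
  set ψ : ℝ → ℂ := fun x => φ x • η x with hψ
  have hs : ContDiff ℝ ∞ ψ := h1.smul hη
  have hc : HasCompactSupport ψ := h2.smul_right
  have ht : tsupport ψ ⊆ Ioo 0 ℓ := (tsupport_smul_subset_left φ η).trans h3
  have hψd : ∀ x, deriv ψ x = φ x • deriv η x + deriv φ x • η x :=
    fun x => ((hφd x).smul (hηd x)).deriv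
  have key := h.complex_test hs hc ht
  have int1 : ∀ (ζ : ℝ → ℂ), Continuous ζ → HasCompactSupport ζ → ∀ e : L2 ℓ,
      Integrable (fun x => ζ x * e x) (volume.restrict (Ioo 0 ℓ)) := by
    intro ζ hζ hc e
    obtain ⟨C, hC⟩ := hζ.bounded_above_of_compact_support hc
    exact (L2.integrableOn e).bdd_mul hζ.aestronglyMeasurable (Filter.Eventually.of_forall hC)
  have i1 := int1 (fun x => φ x • deriv η x)
    (h1.continuous.smul (hη.continuous_deriv (by simp))) h2.smul_right f
  have i2 := int1 (fun x => deriv φ x • η x)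
    ((h1.continuous_deriv (by simp)).smul hη.continuous) h2.deriv.smul_right f
  have i3 := int1 ψ hs.continuous hc g
  have e1 : ∫ x in Ioo 0 ℓ, deriv ψ x * f x
      = (∫ x in Ioo 0 ℓ, (φ x • deriv η x) * f x) + ∫ x in Ioo 0 ℓ, (deriv φ x • η x) * f x := by
    rw [← integral_add i1 i2]
    refine integral_congr_ae (Filter.Eventually.of_forall fun x => ?_)
    simp only [hψd, add_mul]
  have e2 : ∫ x in Ioo 0 ℓ, deriv φ x • F x = ∫ x in Ioo 0 ℓ, (deriv φ x • η x) * f x := by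
    refine integral_congr_ae ?_
    filter_upwards [hF] with x hx
    rw [hx, smul_mul_assoc]
  have e3 : ∫ x in Ioo 0 ℓ, φ x • G x
      = (∫ x in Ioo 0 ℓ, (φ x • deriv η x) * f x) + ∫ x in Ioo 0 ℓ, ψ x * g x := by
    rw [← integral_add i1 i3]
    refine integral_congr_ae ?_
    filter_upwards [hG] with x hx
    rw [hx, smul_add, smul_mul_assoc, smul_mul_assoc]
  rw [e1] at key
  rw [e2, e3]
  linear_combination key

/-- Solvability of the initial value problem `w' = a w + h`, `w(0) = c` in `H¹(0, ℓ)`. -/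
lemma H1.exists_first_order {ℓ : ℝ} (hℓ : 0 < ℓ) (a : ℂ) (h : L2 ℓ) (c : ℂ) :
    ∃ w : H1 ℓ, w.1.2 = a • w.1.1 + h ∧ H1.rep w 0 = c := by
  have hexp : ∀ b : ℂ, ContDiff ℝ ∞ fun x : ℝ => Complex.exp (b * x) := fun b =>
    (contDiff_const.mul Complex.ofRealCLM.contDiff).cexp
  have hexpd : ∀ (b : ℂ) (x : ℝ), deriv (fun x : ℝ => Complex.exp (b * x)) x
      = b * Complex.exp (b * x) := fun b x => by
    have : HasDerivAt (fun x : ℝ => b * (x : ℂ)) (b * 1) x :=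
      (Complex.ofRealCLM.hasDerivAt (x := x)).const_mul b
    rw [this.cexp.deriv]; ring
  -- Integrating factor: `w = e^{ax} u` with `u' = e^{-ax} h` and `u(0) = c`.
  obtain ⟨k, hk⟩ := L2.exists_mul (hexp (-a)).continuous h
  obtain ⟨u, hu, hu0⟩ := H1.exists_primitive hℓ k c
  obtain ⟨W, hW⟩ := L2.exists_mul (hexp a).continuous u.1.1
  have hd : HasWeakDeriv W (a • W + h) := by
    refine HasWeakDeriv.mul (f := u.1.1) (g := u.1.2) u.2 (hexp a) hW ?_
    rw [hu]
    filter_upwards [Lp.coeFn_add (a • W) h, Lp.coeFn_smul a W, hW, hk] with x e1 e2 e3 e4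
    rw [e1, Pi.add_apply, e2, Pi.smul_apply, e3, e4, hexpd, smul_eq_mul]
    have : Complex.exp (a * x) * Complex.exp (-a * x) = 1 := by
      rw [← Complex.exp_add]; simp
    linear_combination (-(h x)) * this
  refine ⟨⟨(W, a • W + h), hd⟩, rfl, ?_⟩
  rw [H1.rep_unique hℓ ⟨(W, a • W + h), hd⟩
    (F := fun x => Complex.exp (a * x) * H1.rep u x)
    ((hexp a).continuous.continuousOn.mul (H1.continuousOn_rep u)) ?_ (left_mem_Icc.2 hℓ.le)]
  · simp [hu0]
  · filter_upwards [hW, H1.rep_ae_eq u] with x e1 e2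
    rw [e1, e2]

/-- Solutions of `w' = a w` are exponentials. -/
lemma H1.rep_eq_exp {ℓ : ℝ} (hℓ : 0 < ℓ) {a : ℂ} {w : H1 ℓ} (h : w.1.2 = a • w.1.1) {x : ℝ}
    (hx : x ∈ Icc 0 ℓ) : H1.rep w x = Complex.exp (a * x) * H1.rep w 0 := by
  have hc := H1.continuousOn_rep w
  have hint : ∀ x ∈ Icc 0 ℓ, H1.rep w x = H1.rep w 0 + ∫ t in (0 : ℝ)..x, a * H1.rep w t := by
    intro x hx
    rw [H1.rep_eq_primitive hℓ w hx, intervalIntegral.integral_of_le hx.1,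
      intervalIntegral.integral_of_le hx.1, integral_Ioc_eq_integral_Ioo,
      integral_Ioc_eq_integral_Ioo, h]
    congr 1
    refine integral_congr_ae ?_
    filter_upwards [ae_restrict_of_ae_restrict_of_subset (Ioo_subset_Ioo_right hx.2)
      (Lp.coeFn_smul a w.1.1),
      ae_restrict_of_ae_restrict_of_subset (Ioo_subset_Ioo_right hx.2) (H1.rep_ae_eq w)]
      with t e1 e2
    rw [e1, Pi.smul_apply, smul_eq_mul, e2]
  have hd : ∀ x ∈ Ico 0 ℓ, HasDerivWithinAt (H1.rep w) (a * H1.rep w x) (Ici x) x := by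
    intro x hx
    have hcm : ContinuousOn (fun t => a * H1.rep w t) (Icc 0 ℓ) := continuousOn_const.mul hc
    have hii : IntervalIntegrable (fun t => a * H1.rep w t) volume 0 x :=
      (hcm.mono (by rw [uIcc_of_le hx.1]; exact Icc_subset_Icc_right hx.2.le)).intervalIntegrable
    have hnear : Icc 0 ℓ ∈ nhdsWithin x (Ioi x) :=
      Filter.mem_of_superset (Ioo_mem_nhdsGT hx.2)
        (fun t ht => ⟨hx.1.trans ht.1.le, ht.2.le⟩)
    have hD := intervalIntegral.integral_hasDerivWithinAt_right (s := Ici x) (t := Ioi x) hii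
      ⟨Icc 0 ℓ, hnear, hcm.aestronglyMeasurable measurableSet_Icc⟩
      ((hcm x ⟨hx.1, hx.2.le⟩).mono_of_mem_nhdsWithin hnear)
    refine (hD.const_add (H1.rep w 0)).congr_of_eventuallyEq ?_ (hint x ⟨hx.1, hx.2.le⟩)
    filter_upwards [Icc_mem_nhdsGE hx.2] with t ht
    exact hint t ⟨hx.1.trans ht.1, ht.2⟩
  have hE : ∀ x : ℝ, HasDerivAt (fun x : ℝ => Complex.exp (-a * x))
      (-a * Complex.exp (-a * x)) x := fun x => by
    have : HasDerivAt (fun x : ℝ => -a * (x : ℂ)) (-a * 1) x :=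
      (Complex.ofRealCLM.hasDerivAt (x := x)).const_mul (-a)
    convert this.cexp using 1; ring
  -- The product `e^{-ax} w` has zero right derivative, hence equals its value at `0`.
  have hconst := constant_of_has_deriv_right_zero
    (f := fun x : ℝ => Complex.exp (-a * x) * H1.rep w x) (a := 0) (b := ℓ)
    (ContinuousOn.mul (fun x _ => (hE x).continuousAt.continuousWithinAt) hc)
    (fun x hx => ((hE x).hasDerivWithinAt.mul (hd x hx)).congr_deriv (by ring)) x hx
  simp only [Complex.ofReal_zero, mul_zero, Complex.exp_zero, one_mul] at hconst
  rw [← hconst, ← mul_assoc, ← Complex.exp_add]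
  simp

lemma H1.eq_zero_of_rep {ℓ : ℝ} {w : H1 ℓ} (h : ∀ x ∈ Icc 0 ℓ, H1.rep w x = 0) : w = 0 := by
  refine H1.ext_fst (Lp.ext ?_)
  filter_upwards [H1.rep_ae_eq w, ae_restrict_mem measurableSet_Ioo,
    Lp.coeFn_zero ℂ 2 (volume.restrict (Ioo 0 ℓ))] with x e hx e0
  rw [← e, h x (Ioo_subset_Icc_self hx)]
  exact e0.symm

/-- Cauchy–Schwarz against the constant `1`, whose `L²` norm is `√ℓ`. -/
lemma L2.integral_norm_le {ℓ : ℝ} (hℓ : 0 < ℓ) (f : L2 ℓ) :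
    ∫ x in Ioo 0 ℓ, ‖f x‖ ≤ √ℓ * ‖f‖ := by
  have h := eLpNorm_le_eLpNorm_mul_rpow_measure_univ (μ := volume.restrict (Ioo 0 ℓ))
    (p := 1) (q := 2) (by norm_num) (Lp.memLp f).aestronglyMeasurable
  rw [eLpNorm_one_eq_lintegral_enorm] at h
  rw [integral_norm_eq_lintegral_enorm (Lp.memLp f).aestronglyMeasurable, Lp.norm_def]
  refine (ENNReal.toReal_mono (ENNReal.mul_ne_top (Lp.memLp f).2.ne ?_) h).trans ?_
  · refine ENNReal.rpow_ne_top_of_nonneg (by norm_num) (by simp)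
  · rw [ENNReal.toReal_mul, mul_comm, ← ENNReal.toReal_rpow]
    gcongr
    simp [hℓ.le, Real.sqrt_eq_rpow]
    norm_num

/-- The embedding `H¹(0, ℓ) ⊆ C[0, ℓ]` is continuous. -/
lemma H1.continuous_eval {ℓ : ℝ} (hℓ : 0 < ℓ) (x : Icc 0 ℓ) : Continuous (H1.eval hℓ x) := by
  have hbound : ∀ u : H1 ℓ, ‖H1.eval hℓ x u‖ ≤ (√ℓ / ℓ + √ℓ) * ‖u‖ := by
    intro u
    change ‖H1.rep u x‖ ≤ _
    have n1 : ‖u.1.1‖ ≤ ‖u‖ := norm_fst_le u.1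
    have n2 : ‖u.1.2‖ ≤ ‖u‖ := norm_snd_le u.1
    -- Compare `u(x)` with `u(t)` through the integral of `u'`, then average over `t`: this bounds
    -- the value by the `L²` norms of `u` and `u'`.
    have pt : ∀ t ∈ Icc 0 ℓ, ‖H1.rep u x‖ ≤ ‖H1.rep u t‖ + √ℓ * ‖u‖ := by
      intro t ht
      have e : H1.rep u x = H1.rep u t + ∫ s in t..x, u.1.2 s := by
        rw [H1.rep_eq_primitive hℓ u x.2, H1.rep_eq_primitive hℓ u ht,
          ← intervalIntegral.integral_add_adjacent_intervals (a := 0) (b := t) (c := x)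
            (L2.intervalIntegrable ht _)
            ((L2.intervalIntegrable ht _).symm.trans (L2.intervalIntegrable x.2 _)), add_assoc]
      rw [e]
      refine (norm_add_le _ _).trans (add_le_add_right ?_ _)
      refine (intervalIntegral.norm_integral_le_integral_norm_uIoc).trans ?_
      refine (setIntegral_mono_set (t := Ioc 0 ℓ) ?_ ?_ ?_).trans ?_
      · exact ((integrableOn_Ioc_iff_integrableOn_Ioo).2 (L2.integrableOn _)).norm
      · exact Filter.Eventually.of_forall fun _ => norm_nonneg _
      · exact (Ioc_subset_Ioc (le_min ht.1 x.2.1) (max_le ht.2 x.2.2)).eventuallyLE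
      · rw [integral_Ioc_eq_integral_Ioo]
        exact (L2.integral_norm_le hℓ _).trans (by gcongr)
    have hi : IntegrableOn (fun t => ‖u.1.1 t‖) (Ioo 0 ℓ) := (L2.integrableOn _).norm
    have hcs : IntegrableOn (fun _ : ℝ => √ℓ * ‖u‖) (Ioo 0 ℓ) := integrableOn_const (by simp)
    have avg : ∫ t in Ioo 0 ℓ, ‖H1.rep u x‖ ≤ ∫ t in Ioo 0 ℓ, (‖u.1.1 t‖ + √ℓ * ‖u‖) := by
      refine integral_mono_ae (integrableOn_const (by simp)) (hi.add hcs) ?_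
      filter_upwards [H1.rep_ae_eq u, ae_restrict_mem measurableSet_Ioo] with t e ht
      have := pt t (Ioo_subset_Icc_self ht)
      rwa [e] at this
    rw [integral_add hi hcs] at avg
    simp only [setIntegral_const, smul_eq_mul, Real.volume_real_Ioo_of_le hℓ.le, sub_zero] at avg
    have b := L2.integral_norm_le hℓ u.1.1
    have b' : √ℓ * ‖u.1.1‖ ≤ √ℓ * ‖u‖ := by gcongr
    have e : (√ℓ / ℓ + √ℓ) * ‖u‖ = (√ℓ * ‖u‖ + ℓ * (√ℓ * ‖u‖)) / ℓ := by field_simp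
    rw [e, le_div_iff₀ hℓ]
    linarith
  exact AddMonoidHomClass.continuous_of_bound (H1.eval hℓ x) _ hbound

/-! ## The equation `y'' = λ² y + h` on an edge -/

/-- Two first-order problems suffice, by `d²/dx² - λ² = (d/dx - λ)(d/dx + λ)`: solve `w' = λ w + h`,
then `u' = -λ u + w`. Since `w = u' + λ u`, its initial value is `b + λ a`. Unlike a basis of
exponentials, this also covers `λ = 0`. -/
lemma H2.exists_solution {ℓ : ℝ} (hℓ : 0 < ℓ) (lam : ℂ) (h : L2 ℓ) (a b : ℂ) :
    ∃ y : H2 ℓ, y.1.2.2 = lam ^ 2 • y.1.1 + h ∧ H1.rep (H2.toH1 y) 0 = a ∧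
      H1.rep (H2.deriv y) 0 = b := by
  obtain ⟨w, hw, hw0⟩ := H1.exists_first_order hℓ lam h (b + lam * a)
  obtain ⟨u, hu, hu0⟩ := H1.exists_first_order hℓ (-lam) w.1.1 a
  have hu' : u.1.2 = ((-lam) • u + w : H1 ℓ).1.1 := hu
  have hd : HasWeakDeriv u.1.2 (lam ^ 2 • u.1.1 + h) := by
    have := ((-lam) • u + w : H1 ℓ).2
    have e : ((-lam) • u + w : H1 ℓ).1.2 = lam ^ 2 • u.1.1 + h := by
      change (-lam) • u.1.2 + w.1.2 = _
      rw [hu, hw]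
      module
    rw [hu', ← e]
    exact this
  let y : H2 ℓ := ⟨(u.1.1, u.1.2, lam ^ 2 • u.1.1 + h), u.2, hd⟩
  refine ⟨y, rfl, hu0, ?_⟩
  have e : H2.deriv y = (-lam) • u + w := H1.ext_fst hu'
  have hev : H1.eval hℓ ⟨0, le_rfl, hℓ.le⟩ (H2.deriv y)
      = (-lam) * H1.rep u 0 + H1.rep w 0 := by
    rw [e, map_add, map_smul]; rfl
  have : H1.rep (H2.deriv y) 0 = (-lam) * H1.rep u 0 + H1.rep w 0 := hev
  rw [this, hu0, hw0]
  ring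

/-- The factorization `d²/dx² - λ² = (d/dx - λ)(d/dx + λ)`. -/
lemma H2.rep_deriv_add {ℓ : ℝ} (hℓ : 0 < ℓ) {lam : ℂ} {y : H2 ℓ}
    (hy : y.1.2.2 = lam ^ 2 • y.1.1) {x : ℝ} (hx : x ∈ Icc 0 ℓ) :
    H1.rep (H2.deriv y) x + lam * H1.rep (H2.toH1 y) x
      = Complex.exp (lam * x) * (H1.rep (H2.deriv y) 0 + lam * H1.rep (H2.toH1 y) 0) := by
  have hrep : ∀ z ∈ Icc 0 ℓ, H1.rep (H2.deriv y + lam • H2.toH1 y) z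
      = H1.rep (H2.deriv y) z + lam * H1.rep (H2.toH1 y) z := by
    intro z hz
    change H1.eval hℓ ⟨z, hz⟩ (H2.deriv y + lam • H2.toH1 y) = _
    rw [map_add, map_smul]; rfl
  rw [← hrep x hx, ← hrep 0 (left_mem_Icc.2 hℓ.le)]
  refine H1.rep_eq_exp hℓ ?_ hx
  change y.1.2.2 + lam • y.1.2.1 = lam • (y.1.2.1 + lam • y.1.1)
  rw [hy]
  module

lemma H2.eq_zero_of_toH1 {ℓ : ℝ} {y : H2 ℓ} (h : H2.toH1 y = 0) : y = 0 := by
  have e1 : y.1.1 = 0 := congrArg (fun u => u.1.1) h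
  have e2 : y.1.2.1 = 0 := congrArg (fun u => u.1.2) h
  have d := y.2.2
  rw [e2] at d
  exact Subtype.ext (Prod.ext e1 (Prod.ext e2 (d.unique HasWeakDeriv.zero)))

/-- Uniqueness for the Cauchy problem with data at an arbitrary point. -/
lemma H2.eq_zero_of_data {ℓ : ℝ} (hℓ : 0 < ℓ) {lam : ℂ} {y : H2 ℓ}
    (hy : y.1.2.2 = lam ^ 2 • y.1.1) {x : ℝ} (hx : x ∈ Icc 0 ℓ)
    (h0 : H1.rep (H2.toH1 y) x = 0) (h1 : H1.rep (H2.deriv y) x = 0) : y = 0 := by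
  have hc : H1.rep (H2.deriv y) 0 + lam * H1.rep (H2.toH1 y) 0 = 0 := by
    have := H2.rep_deriv_add hℓ hy hx
    rw [h0, h1, mul_zero, add_zero] at this
    exact (mul_eq_zero.1 this.symm).resolve_left (Complex.exp_ne_zero _)
  -- Since `y' + λ y` is a multiple of `e^{λx}` vanishing at one point, it is zero; so `y' = -λ y`,
  -- and the same argument applies to `y`.
  have hw : H2.deriv y + lam • H2.toH1 y = 0 := by
    refine H1.eq_zero_of_rep fun z hz => ?_
    have e : H1.rep (H2.deriv y + lam • H2.toH1 y) z
        = H1.rep (H2.deriv y) z + lam * H1.rep (H2.toH1 y) z := by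
      change H1.eval hℓ ⟨z, hz⟩ (H2.deriv y + lam • H2.toH1 y) = _
      rw [map_add, map_smul]; rfl
    rw [e, H2.rep_deriv_add hℓ hy hz, hc, mul_zero]
  have hy' : (H2.toH1 y).1.2 = (-lam) • (H2.toH1 y).1.1 := by
    have : y.1.2.1 + lam • y.1.1 = 0 := congrArg (fun u => u.1.1) hw
    change y.1.2.1 = (-lam) • y.1.1
    rw [eq_neg_of_add_eq_zero_left this, neg_smul]
  refine H2.eq_zero_of_toH1 (H1.eq_zero_of_rep fun z hz => ?_)
  have ex := H1.rep_eq_exp hℓ hy' hx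
  rw [h0] at ex
  rw [H1.rep_eq_exp hℓ hy' hz, (mul_eq_zero.1 ex.symm).resolve_left (Complex.exp_ne_zero _),
    mul_zero]

/-- Conservation of `Im (y' ȳ)` for the solutions of `y'' = -β² y`. -/
lemma H2.im_deriv_mul_conj {ℓ : ℝ} (hℓ : 0 < ℓ) {β : ℝ} (hβ : β ≠ 0) {y : H2 ℓ}
    (hy : y.1.2.2 = (Complex.I * β) ^ 2 • y.1.1) :
    (H1.rep (H2.deriv y) ℓ * (starRingEnd ℂ) (H1.rep (H2.toH1 y) ℓ)).im
      = (H1.rep (H2.deriv y) 0 * (starRingEnd ℂ) (H1.rep (H2.toH1 y) 0)).im := by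
  have hy' : y.1.2.2 = (-(Complex.I * β)) ^ 2 • y.1.1 := by rw [neg_sq]; exact hy
  have hx : ℓ ∈ Icc 0 ℓ := right_mem_Icc.2 hℓ.le
  -- Both `y' + iβ y` and `y' - iβ y` evolve by a phase, so their moduli are conserved; the
  -- difference of the squared moduli is `4β Im (y' ȳ)`.
  have n1 := congrArg Complex.normSq (H2.rep_deriv_add hℓ hy hx)
  have n2 := congrArg Complex.normSq (H2.rep_deriv_add hℓ hy' hx)
  have hn : ∀ r : ℝ, Complex.normSq (Complex.exp (Complex.I * r)) = 1 := by
    intro r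
    rw [Complex.normSq_eq_norm_sq, mul_comm, Complex.norm_exp_ofReal_mul_I, one_pow]
  rw [Complex.normSq_mul, show Complex.I * (β : ℂ) * (ℓ : ℂ) = Complex.I * ((β * ℓ : ℝ) : ℂ) by
    push_cast; ring, hn] at n1
  rw [Complex.normSq_mul, show -(Complex.I * (β : ℂ)) * (ℓ : ℂ)
    = Complex.I * ((-(β * ℓ) : ℝ) : ℂ) by push_cast; ring, hn] at n2
  simp only [Complex.normSq_apply, Complex.add_re, Complex.add_im, Complex.mul_re, Complex.mul_im,
    Complex.neg_re, Complex.neg_im, Complex.I_re, Complex.I_im, Complex.ofReal_re,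
    Complex.ofReal_im, Complex.conj_re, Complex.conj_im] at n1 n2 ⊢
  have h4 : (4 * β) ≠ 0 := by positivity
  apply mul_left_cancel₀ h4
  linear_combination n1 - n2

/-- With `y = 0` at both ends, the two factorizations give `y'(ℓ) = e^{iℓ} y'(0) = e^{-iℓ} y'(0)`.
So `y'(0) = 0`, or `sin ℓ = 0` and `ℓ` is a positive multiple of `π`. -/
lemma H2.dirichlet_eq_zero {ℓ : ℝ} (hℓ : 0 < ℓ) (hπ : ∀ m : ℕ, 1 ≤ m → ℓ ≠ m * Real.pi) {β : ℝ}
    (hβ : β = 1 ∨ β = -1) {y : H2 ℓ} (hy : y.1.2.2 = (Complex.I * β) ^ 2 • y.1.1)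
    (h0 : H1.rep (H2.toH1 y) 0 = 0) (h1 : H1.rep (H2.toH1 y) ℓ = 0) : y = 0 := by
  have hI : y.1.2.2 = Complex.I ^ 2 • y.1.1 := by
    rw [hy]; rcases hβ with rfl | rfl <;> simp
  have hI' : y.1.2.2 = (-Complex.I) ^ 2 • y.1.1 := by rw [neg_sq]; exact hI
  have hx : ℓ ∈ Icc 0 ℓ := right_mem_Icc.2 hℓ.le
  have n1 := H2.rep_deriv_add hℓ hI hx
  have n2 := H2.rep_deriv_add hℓ hI' hx
  rw [h0, h1] at n1 n2
  simp only [mul_zero, add_zero] at n1 n2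
  refine H2.eq_zero_of_data hℓ hI (left_mem_Icc.2 hℓ.le) h0 ?_
  by_contra hd
  have e : Complex.exp (Complex.I * ℓ) = Complex.exp (-Complex.I * ℓ) :=
    mul_right_cancel₀ hd (n1.symm.trans n2)
  have hs : Complex.sin ℓ = 0 := by
    rw [Complex.sin, show -(ℓ : ℂ) * Complex.I = -Complex.I * ℓ by ring, mul_comm (ℓ : ℂ), e]
    simp
  have hs' : Real.sin ℓ = 0 := by exact_mod_cast hs
  obtain ⟨n, hn⟩ := Real.sin_eq_zero_iff.1 hs'
  have hn0 : 0 < n := by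
    have : 0 < (n : ℝ) * Real.pi := by rw [hn]; exact hℓ
    exact_mod_cast pos_of_mul_pos_left this Real.pi_pos.le
  lift n to ℕ using hn0.le
  exact hπ n (by exact_mod_cast hn0) (by rw [← hn]; simp)

/-- This is the sine; the normalization `y'(0) = 1` later certifies that it is not zero. -/
lemma H2.exists_dirichlet {ℓ : ℝ} (hℓ : 0 < ℓ) {m : ℕ} (hπ : ℓ = m * Real.pi) :
    ∃ y : H2 ℓ, y.1.2.2 = Complex.I ^ 2 • y.1.1 ∧ H1.rep (H2.toH1 y) 0 = 0 ∧
      H1.rep (H2.toH1 y) ℓ = 0 ∧ H1.rep (H2.deriv y) 0 = 1 := by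
  obtain ⟨y, hI, h0, h1⟩ := H2.exists_solution hℓ Complex.I 0 0 1
  rw [add_zero] at hI
  refine ⟨y, hI, h0, ?_, h1⟩
  have hI' : y.1.2.2 = (-Complex.I) ^ 2 • y.1.1 := by rw [neg_sq]; exact hI
  have hx : ℓ ∈ Icc 0 ℓ := right_mem_Icc.2 hℓ.le
  have n1 := H2.rep_deriv_add hℓ hI hx
  have n2 := H2.rep_deriv_add hℓ hI' hx
  rw [h0, h1] at n1 n2
  have hs : Complex.sin ℓ = 0 := by
    have : Real.sin ℓ = 0 := by rw [hπ]; exact Real.sin_nat_mul_pi m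
    exact_mod_cast this
  rw [Complex.sin] at hs
  have e : Complex.exp (-Complex.I * ℓ) - Complex.exp (Complex.I * ℓ) = 0 := by
    have := (mul_eq_zero.1 ((div_eq_zero_iff.1 hs).resolve_right two_ne_zero)).resolve_right
      Complex.I_ne_zero
    rwa [show -(ℓ : ℂ) * Complex.I = -Complex.I * ℓ by ring, mul_comm (ℓ : ℂ)] at this
  have h2 : (2 * Complex.I) * H1.rep (H2.toH1 y) ℓ = 0 := by
    linear_combination n1 - n2 - e
  exact (mul_eq_zero.1 h2).resolve_left (by simp)

/-- For `λ = 0` the solutions are affine. -/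
lemma H2.rep_sub_of_deriv_deriv_eq_zero {ℓ : ℝ} (hℓ : 0 < ℓ) {y : H2 ℓ}
    (hd : H1.rep (H2.deriv y) 0 = 0) (hy : y.1.2.2 = 0) :
    H1.rep (H2.toH1 y) ℓ = H1.rep (H2.toH1 y) 0 := by
  have hy' : y.1.2.2 = (0 : ℂ) ^ 2 • y.1.1 := by rw [hy]; simp
  have hz : H2.deriv y = 0 := H1.eq_zero_of_rep fun x hx => by
    simpa [hd] using H2.rep_deriv_add hℓ hy' hx
  have h0 : (H2.toH1 y).1.2 = (0 : ℂ) • (H2.toH1 y).1.1 := by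
    rw [zero_smul]
    exact congrArg (fun u => u.1.1) hz
  simpa using H1.rep_eq_exp hℓ h0 (right_mem_Icc.2 hℓ.le)

end FluidTree

/-! ## Combinatorics of trees -/

/-- In a finite tree, if a set of edges is not empty, then some vertex other than a given one lies
on exactly one of them. -/
lemma SimpleGraph.IsTree.exists_ne_unique_neighbor {V : Type*} [Finite V] {G : SimpleGraph V}
    (hG : G.IsTree) (r : V) (B : V → V → Prop) (hBG : ∀ u w, B u w → G.Adj u w)
    (hB : ∃ u w, B u w ∧ B w u) : ∃ w, w ≠ r ∧ ∃ u, B w u ∧ ∀ x, B w x → B x w → x = u := by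
  classical
  cases nonempty_fintype V
  -- Take a longest path from `r` whose last edge satisfies `B`; its end is the required vertex.
  set P : ℕ → Prop := fun n => ∃ (w : V) (p : G.Walk r w), p.IsPath ∧ ¬ p.Nil ∧
    B w p.penultimate ∧ p.length = n with hP
  have hex : ∃ n, P n := by
    obtain ⟨u, w, huw, hwu⟩ := hB
    obtain ⟨p, hp, -⟩ := hG.existsUnique_path r u
    by_cases hw : w ∈ p.support
    · have e := hG.isAcyclic.eq_penultimate_of_adj_end hp (hBG _ _ huw) hw
      refine ⟨_, u, p, hp, ?_, e ▸ huw, rfl⟩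
      intro hnil
      have := hBG _ _ huw
      rw [Walk.nil_iff_support_eq.1 hnil, List.mem_singleton] at hw
      have hru := hnil.eq
      subst hw
      exact this.ne hru.symm
    · refine ⟨_, w, p.concat (hBG _ _ huw), hp.concat hw _, ?_, ?_, rfl⟩
      · rw [← Walk.length_eq_zero_iff, Walk.length_concat]; omega
      · rwa [Walk.penultimate_concat]
  have hbd : ∀ n, P n → n ≤ Fintype.card V := by
    rintro n ⟨w, p, hp, -, -, rfl⟩
    exact hp.length_lt.le
  obtain ⟨n, hn⟩ := hex
  obtain ⟨w, p, hp, hnil, hb, hlen⟩ := Nat.findGreatest_spec (hbd n hn) hn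
  refine ⟨w, ?_, p.penultimate, hb, fun x hx hx' => ?_⟩
  · rintro rfl
    exact hnil (Walk.isPath_iff_nil.1 hp)
  · by_contra hne
    -- By acyclicity a neighbor of the end lying on the path is the penultimate vertex; any other
    -- `B`-neighbor would lengthen the path.
    have hns : x ∉ p.support := fun hs =>
      hne (hG.isAcyclic.eq_penultimate_of_adj_end hp (hBG _ _ hx) hs)
    have hPn : P (p.length + 1) := by
      refine ⟨x, p.concat (hBG _ _ hx), hp.concat hns _, ?_, ?_, Walk.length_concat _ _⟩
      · rw [← Walk.length_eq_zero_iff, Walk.length_concat]; omega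
      · rwa [Walk.penultimate_concat]
    have := Nat.le_findGreatest (hbd _ hPn) hPn
    omega

/-! ### Incidence of vertices and edges in a metric tree -/

namespace FluidTree

namespace MetricTree

variable {V E : Type*} (T : MetricTree V E)

lemma pos_term (j : E) : (T.pos (T.term j) j : ℝ) = T.len j := by simp [pos]

lemma pos_init (j : E) : (T.pos (T.init j) j : ℝ) = 0 := by
  simp [pos, (T.init_ne_term j).symm]

lemma inc_term (j : E) : T.inc (T.term j) j = 1 := by simp [inc]

lemma inc_init (j : E) : T.inc (T.init j) j = -1 := by
  simp [inc, (T.init_ne_term j).symm]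

lemma trace_term (j : E) (u : H1 (T.len j)) : T.trace (T.term j) j u = H1.rep u (T.len j) := by
  change H1.rep u (T.pos (T.term j) j) = _
  rw [pos_term]

lemma trace_init (j : E) (u : H1 (T.len j)) : T.trace (T.init j) j u = H1.rep u 0 := by
  change H1.rep u (T.pos (T.init j) j) = _
  rw [pos_init]

lemma slope_apply (k : V) (j : E) (u : H2 (T.len j)) :
    T.slope k j u = T.inc k j * H1.rep (H2.deriv u) (T.pos k j) := rfl

lemma adj_iff {u w : V} :
    (SimpleGraph.fromEdgeSet (range fun j => s(T.init j, T.term j))).Adj u w ↔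
      ∃ j, s(T.init j, T.term j) = s(u, w) := by
  rw [SimpleGraph.fromEdgeSet_adj]
  refine ⟨fun h => h.1, fun ⟨j, hj⟩ => ⟨⟨j, hj⟩, ?_⟩⟩
  rintro rfl
  have := T.init_ne_term j
  rw [Sym2.eq_iff] at hj
  rcases hj with ⟨h1, h2⟩ | ⟨h1, h2⟩ <;> exact this (h1.trans h2.symm)

variable [Fintype E]

lemma mem_adj {k : V} {j : E} : j ∈ T.adj k ↔ T.init j = k ∨ T.term j = k := by
  simp [adj]

lemma inc_ne_zero {k : V} {j : E} (h : j ∈ T.adj k) : T.inc k j ≠ 0 := by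
  rcases T.mem_adj.1 h with rfl | rfl
  · simp [inc_init]
  · simp [inc_term]

lemma flux_apply (k : V) (y : ∀ j, H2 (T.len j)) :
    T.flux k y = ∑ j ∈ T.adj k, T.slope k j (y j) := by
  simp [flux, LinearMap.sum_apply]

lemma adj_root_card : (T.adj T.root).card = 1 := by
  obtain ⟨j, hj, hu⟩ := T.root_exterior
  refine Finset.card_eq_one.2 ⟨j, ?_⟩
  ext i
  rw [Finset.mem_singleton, T.mem_adj]
  exact ⟨hu i, fun h => h ▸ hj⟩

lemma not_isInterior_root : ¬ T.IsInterior T.root := by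
  rw [IsInterior, adj_root_card]
  exact lt_irrefl 1

lemma IsLeaf.not_isInterior {T : MetricTree V E} {k : V} (h : T.IsLeaf k) : ¬ T.IsInterior k := by
  rw [IsInterior, h.1]
  exact lt_irrefl 1

lemma adj_nonempty' (k : V) : (T.adj k).Nonempty := by
  by_cases hk : k = T.root
  · rw [hk, ← Finset.card_pos, adj_root_card]
    exact Nat.one_pos
  obtain ⟨p⟩ := T.isTree.connected k T.root
  obtain ⟨j, hj⟩ := T.adj_iff.1 (p.adj_snd (fun h => hk h.eq))
  rw [Sym2.eq_iff] at hj
  refine ⟨j, T.mem_adj.2 ?_⟩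
  rcases hj with h | h
  · exact Or.inl h.1
  · exact Or.inr h.2

lemma eq_root_or_isLeaf_or_isInterior (k : V) : k = T.root ∨ T.IsLeaf k ∨ T.IsInterior k := by
  have h := Finset.card_pos.2 (T.adj_nonempty' k)
  by_cases hk : k = T.root
  · exact Or.inl hk
  by_cases h1 : (T.adj k).card = 1
  · exact Or.inr (Or.inl ⟨h1, hk⟩)
  · exact Or.inr (Or.inr (by rw [IsInterior]; omega))

/-- Double counting of half-edges: every edge is adjacent to exactly its two distinct ends. It turns
a balance over vertices into one over edges. -/
lemma sum_adj [Fintype V] {M : Type*} [AddCommMonoid M] (F : V → E → M) :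
    ∑ k, ∑ j ∈ T.adj k, F k j = ∑ j, (F (T.init j) j + F (T.term j) j) := by
  classical
  rw [Finset.sum_comm' (s' := fun j => {T.init j, T.term j}) (t' := Finset.univ)]
  · exact Finset.sum_congr rfl fun j _ => Finset.sum_pair (T.init_ne_term j)
  · intro k j
    simp [T.mem_adj, eq_comm]

/-- A nonempty set of edges has exactly one edge at some vertex other than the root. -/
lemma exists_unique_edge [Finite V] (B : E → Prop) (hB : ∃ j, B j) :
    ∃ k, k ≠ T.root ∧ ∃ j ∈ T.adj k, B j ∧ ∀ i ∈ T.adj k, B i → i = j := by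
  obtain ⟨j₀, hj₀⟩ := hB
  obtain ⟨w, hw, u, ⟨j, hj, e⟩, hu⟩ := T.isTree.exists_ne_unique_neighbor T.root
    (fun u w => ∃ j, B j ∧ s(T.init j, T.term j) = s(u, w))
    (fun u w ⟨j, _, hj⟩ => T.adj_iff.2 ⟨j, hj⟩)
    ⟨T.init j₀, T.term j₀, ⟨j₀, hj₀, rfl⟩, ⟨j₀, hj₀, Sym2.eq_swap⟩⟩
  refine ⟨w, hw, j, ?_, hj, fun i hi hBi => ?_⟩
  · rw [Sym2.eq_iff] at e
    exact T.mem_adj.2 (e.imp And.left And.right)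
  · obtain ⟨x, hx⟩ : ∃ x, s(T.init i, T.term i) = s(w, x) := by
      rcases T.mem_adj.1 hi with h | h
      · exact ⟨T.term i, by rw [h]⟩
      · exact ⟨T.init i, by rw [h, Sym2.eq_swap]⟩
    have := hu x ⟨i, hBi, hx⟩ ⟨i, hBi, hx.trans Sym2.eq_swap⟩
    subst this
    exact T.edge_injective (hx.trans e.symm)

lemma nodeValue_eq (k : T.Interior) (u : T.VSpace) {j : E} (hj : j ∈ T.adj k.1) :
    T.nodeValue k u = T.trace k.1 j (u.1 j) :=
  u.2.2 k.1 k.2 _ (T.adj_nonempty k).choose_spec _ hj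

/-! ### Modes for purely imaginary `λ` -/

/-- The pairs `(y, p)` that come from the solutions of `A (y, v, p, q) = λ (y, v, p, q)`. -/
structure IsMode (lam : ℂ) (y : ∀ j, H2 (T.len j)) (p : T.Interior → ℂ) : Prop where
  ode : ∀ j, (y j).1.2.2 = lam ^ 2 • (y j).1.1
  mem : T.toH1 y ∈ T.VSpace
  flux_eq : ∀ k : T.Interior, T.flux k.1 y = lam * p k
  leaf : ∀ k, T.IsLeaf k → ∀ j ∈ T.adj k,
    T.slope k j (y j) = - (lam * T.trace k j (H2.toH1 (y j)))
  node : ∀ k, (lam ^ 2 + 1) * p k + lam * T.nodeValue k ⟨T.toH1 y, mem⟩ = 0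

namespace IsMode

variable {T} {lam : ℂ} {y : ∀ j, H2 (T.len j)} {p : T.Interior → ℂ}

lemma eq_zero_of_data (h : T.IsMode lam y p) {k : V} {j : E} (hj : j ∈ T.adj k)
    (h0 : T.trace k j (H2.toH1 (y j)) = 0) (h1 : T.slope k j (y j) = 0) : y j = 0 := by
  rw [slope_apply] at h1
  exact H2.eq_zero_of_data (T.len_pos j) (h.ode j) (T.pos k j).2 h0
    ((mul_eq_zero.1 h1).resolve_left (T.inc_ne_zero hj))

lemma nodeValue_eq (h : T.IsMode lam y p) (k : T.Interior) {j : E} (hj : j ∈ T.adj k.1) :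
    T.nodeValue k ⟨T.toH1 y, h.mem⟩ = T.trace k.1 j (H2.toH1 (y j)) :=
  T.nodeValue_eq k _ hj

lemma p_eq_zero (h : T.IsMode lam y p) (hlam : lam ≠ 0) (hy : ∀ j, y j = 0) : p = 0 := by
  funext k
  have := h.flux_eq k
  rw [flux_apply, Finset.sum_eq_zero (fun j _ => by rw [hy j, map_zero])] at this
  exact (mul_eq_zero.1 this.symm).resolve_left hlam

/-- The flux balance forces a solution to vanish at the leaves. -/
lemma leaf_eq_zero [Finite V] {β : ℝ} (hβ : β ≠ 0) (h : T.IsMode (Complex.I * β) y p) {k : V}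
    (hk : T.IsLeaf k) {j : E} (hj : j ∈ T.adj k) : y j = 0 := by
  cases nonempty_fintype V
  set W : V → E → ℝ := fun k j =>
    (T.slope k j (y j) * (starRingEnd ℂ) (T.trace k j (H2.toH1 (y j)))).im with hW
  have htot : ∑ k, ∑ j ∈ T.adj k, W k j = 0 := by
    rw [sum_adj]
    refine Finset.sum_eq_zero fun j _ => ?_
    have := H2.im_deriv_mul_conj (T.len_pos j) hβ (h.ode j)
    simp only [hW, slope_apply, inc_init, inc_term, pos_init, pos_term, trace_init, trace_term]
    rw [neg_one_mul, neg_mul, one_mul, this, Complex.neg_im, neg_add_cancel]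
  have hleaf : ∀ k, T.IsLeaf k → ∀ j ∈ T.adj k,
      W k j = - (β * Complex.normSq (T.trace k j (H2.toH1 (y j)))) := by
    intro k hk j hj
    simp only [hW]
    rw [h.leaf k hk j hj, neg_mul, mul_assoc, Complex.mul_conj, mul_assoc]
    simp [Complex.normSq_apply]
  -- The factor `β` gives all vertex contributions the same sign whatever the sign of `β`, so a zero
  -- total makes each of them vanish.
  have hle : ∀ k, β * ∑ j ∈ T.adj k, W k j ≤ 0 := by
    intro k
    rcases T.eq_root_or_isLeaf_or_isInterior k with hr | hl | hi
    · rw [Finset.sum_eq_zero, mul_zero]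
      intro j hj
      subst hr
      have : T.trace T.root j (H2.toH1 (y j)) = 0 := h.mem.1 j hj
      simp only [hW, this, map_zero, mul_zero, Complex.zero_im]
    · rw [Finset.mul_sum]
      refine Finset.sum_nonpos fun j hj => ?_
      rw [hleaf k hl j hj]
      have := Complex.normSq_nonneg (T.trace k j (H2.toH1 (y j)))
      nlinarith [mul_nonneg (mul_self_nonneg β) this]
    · set c := T.nodeValue ⟨k, hi⟩ ⟨T.toH1 y, h.mem⟩ with hc
      have e : ∑ j ∈ T.adj k, W k j = (T.flux k y * (starRingEnd ℂ) c).im := by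
        rw [flux_apply, Finset.sum_mul, Complex.im_sum]
        refine Finset.sum_congr rfl fun j hj => ?_
        rw [hc, h.nodeValue_eq ⟨k, hi⟩ hj]
      have hf := h.flux_eq ⟨k, hi⟩
      have hn := h.node ⟨k, hi⟩
      rw [← hc] at hn
      simp only at hf
      rw [e, hf]
      refine le_of_eq ?_
      rw [mul_eq_zero]
      right
      have hsq : (Complex.I * (β : ℂ)) ^ 2 = -((β ^ 2 : ℝ) : ℂ) := by
        rw [mul_pow, Complex.I_sq]; push_cast; ring
      rw [hsq] at hn
      -- The node equation reads `(1 - β²) p = -iβ c`. For `β² = 1` it gives `c = 0`; otherwise `iβ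
      -- p c̄` equals `β² |c|² / (1 - β²)`, which is real.
      by_cases hb : β ^ 2 = 1
      · rw [hb] at hn
        have : c = 0 := by
          simpa [hβ] using hn
        rw [this, map_zero, mul_zero, Complex.zero_im]
      · have hb' : 1 - β ^ 2 ≠ 0 := fun h => hb (by linarith)
        have hx : ((1 - β ^ 2 : ℝ) : ℂ) * (Complex.I * β * p ⟨k, hi⟩ * (starRingEnd ℂ) c)
            = ((β ^ 2 * Complex.normSq c : ℝ) : ℂ) := by
          have e2 : ((Complex.normSq c : ℝ) : ℂ) = c * (starRingEnd ℂ) c :=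
            (Complex.mul_conj c).symm
          rw [Complex.ofReal_mul, e2]
          push_cast at hn ⊢
          linear_combination (Complex.I * β * (starRingEnd ℂ) c) * hn
            - (β ^ 2 * c * (starRingEnd ℂ) c) * Complex.I_sq
        have := congrArg Complex.im hx
        rw [Complex.im_ofReal_mul, Complex.ofReal_im] at this
        exact (mul_eq_zero.1 this).resolve_left hb'
  have hz : β * ∑ j ∈ T.adj k, W k j = 0 := by
    refine (Finset.sum_eq_zero_iff_of_nonpos (s := Finset.univ) (fun k _ => hle k)).1 ?_ k
      (Finset.mem_univ k)
    rw [← Finset.mul_sum, htot, mul_zero]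
  obtain ⟨i, hi⟩ := Finset.card_eq_one.1 hk.1
  obtain rfl : j = i := by rwa [hi, Finset.mem_singleton] at hj
  rw [hi, Finset.sum_singleton, hleaf k hk j hj, mul_neg, neg_eq_zero] at hz
  have ht : T.trace k j (H2.toH1 (y j)) = 0 := by simpa [hβ] using hz
  refine h.eq_zero_of_data hj ht ?_
  rw [h.leaf k hk j hj, ht, mul_zero, neg_zero]

/-- An interior vertex has a second edge besides `j`, and continuity transports the zero value from
it. -/
lemma trace_eq_zero_of_other (h : T.IsMode lam y p) (k : T.Interior) {j : E}
    (ho : ∀ i ∈ T.adj k.1, i ≠ j → y i = 0) :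
    T.nodeValue k ⟨T.toH1 y, h.mem⟩ = 0 := by
  obtain ⟨i, hi, hij⟩ := Finset.exists_mem_ne k.2 j
  rw [h.nodeValue_eq k hi, ho i hi hij, map_zero, map_zero]

/-- Peeling: at a vertex with a single nonzero edge, `y(a_k) = 0` by continuity, so `p_k = 0`
because `λ² + 1 ≠ 0`. The flux then reduces to that edge's slope, and both Cauchy data vanish. -/
lemma eq_zero_of_sq_ne_one [Finite V] {β : ℝ} (hβ : β ≠ 0) (hβ1 : β ^ 2 ≠ 1)
    (h : T.IsMode (Complex.I * β) y p) (j : E) : y j = 0 := by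
  by_contra hne
  obtain ⟨k, hk, j, hj, hjne, hu⟩ := T.exists_unique_edge (fun j => y j ≠ 0) ⟨j, hne⟩
  have hu' : ∀ i ∈ T.adj k, i ≠ j → y i = 0 := fun i hi hij => by
    by_contra hc
    exact hij (hu i hi hc)
  rcases (T.eq_root_or_isLeaf_or_isInterior k).resolve_left hk with hl | hi
  · exact hjne (h.leaf_eq_zero hβ hl hj)
  · have hc := h.trace_eq_zero_of_other ⟨k, hi⟩ hu'
    have hn := h.node ⟨k, hi⟩
    have hf := h.flux_eq ⟨k, hi⟩
    rw [hc, mul_zero, add_zero] at hn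
    have hb : (Complex.I * (β : ℂ)) ^ 2 + 1 ≠ 0 := by
      rw [mul_pow, Complex.I_sq]
      intro h0
      apply hβ1
      have : ((β ^ 2 : ℝ) : ℂ) = 1 := by push_cast; linear_combination -h0
      exact_mod_cast this
    rw [(mul_eq_zero.1 hn).resolve_left hb, mul_zero, flux_apply,
      Finset.sum_eq_single_of_mem j hj (fun i hi hij => by rw [hu' i hi hij, map_zero])] at hf
    exact hjne (h.eq_zero_of_data hj ((h.nodeValue_eq ⟨k, hi⟩ hj).symm.trans hc) hf)

/-- Here `λ² + 1 = 0`, so the node equation becomes `λ y(a_k) = 0` and the edges decouple into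
Dirichlet problems. -/
lemma eq_zero_of_eq_one [Finite V] (hT : T.IsPiTree) {β : ℝ} (hβ : β = 1 ∨ β = -1)
    (h : T.IsMode (Complex.I * β) y p) (j : E) : y j = 0 := by
  have hβ0 : β ≠ 0 := by rcases hβ with rfl | rfl <;> norm_num
  by_cases h1 : T.IsLeaf (T.init j)
  · exact h.leaf_eq_zero hβ0 h1 (T.mem_adj.2 (Or.inl rfl))
  by_cases h2 : T.IsLeaf (T.term j)
  · exact h.leaf_eq_zero hβ0 h2 (T.mem_adj.2 (Or.inr rfl))
  have htr : ∀ k, ¬ T.IsLeaf k → j ∈ T.adj k → T.trace k j (H2.toH1 (y j)) = 0 := by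
    intro k hk hj
    rcases T.eq_root_or_isLeaf_or_isInterior k with rfl | hl | hi
    · exact h.mem.1 j hj
    · exact absurd hl hk
    · rw [← h.nodeValue_eq ⟨k, hi⟩ hj]
      have hn := h.node ⟨k, hi⟩
      have hb : (Complex.I * (β : ℂ)) ^ 2 + 1 = 0 := by
        rcases hβ with rfl | rfl <;> simp
      rw [hb, zero_mul, zero_add] at hn
      exact (mul_eq_zero.1 hn).resolve_left (by simp [hβ0])
  refine H2.dirichlet_eq_zero (T.len_pos j) (hT j h1 h2) hβ (h.ode j) ?_ ?_
  · rw [← trace_init]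
    exact htr _ h1 (T.mem_adj.2 (Or.inl rfl))
  · rw [← trace_term]
    exact htr _ h2 (T.mem_adj.2 (Or.inr rfl))

/-- The energy balance carries no information at `λ = 0`. The slopes, constant on each edge, are
peeled off by the flux conditions, which are now homogeneous at interior vertices and leaves; then
`y` is constant on each edge. -/
lemma eq_zero_of_zero [Finite V] (h : T.IsMode 0 y p) (j : E) : y j = 0 := by
  have hode : ∀ j, (y j).1.2.2 = 0 := fun j => by rw [h.ode j]; simp
  have hder : ∀ (j : E) (k : V),
      H1.rep (H2.deriv (y j)) (T.pos k j) = H1.rep (H2.deriv (y j)) 0 := fun j k => by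
    simpa using H2.rep_deriv_add (T.len_pos j) (h.ode j) (T.pos k j).2
  have hd : ∀ j, H1.rep (H2.deriv (y j)) 0 = 0 := by
    by_contra! hne
    obtain ⟨k, hk, j, hj, hjne, hu⟩ := T.exists_unique_edge _ hne
    have hs : T.slope k j (y j) ≠ 0 := by
      rw [slope_apply, hder]
      exact mul_ne_zero (T.inc_ne_zero hj) hjne
    rcases (T.eq_root_or_isLeaf_or_isInterior k).resolve_left hk with hl | hi
    · exact hs (by rw [h.leaf k hl j hj, zero_mul, neg_zero])
    · have hf := h.flux_eq ⟨k, hi⟩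
      rw [zero_mul, flux_apply, Finset.sum_eq_single_of_mem j hj] at hf
      · exact hs hf
      · intro i hi hij
        rw [slope_apply, hder, mul_eq_zero]
        right
        by_contra hc
        exact hij (hu i hi hc)
  have hends : ∀ j, T.trace (T.term j) j (H2.toH1 (y j)) = T.trace (T.init j) j (H2.toH1 (y j)) :=
    fun j => by
      rw [trace_term, trace_init]
      exact H2.rep_sub_of_deriv_deriv_eq_zero (T.len_pos j) (hd j) (hode j)
  have hstep : ∀ k, (∃ j ∈ T.adj k, T.trace k j (H2.toH1 (y j)) = 0) →
      ∀ j ∈ T.adj k, T.trace k j (H2.toH1 (y j)) = 0 := by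
    rintro k ⟨i, hi, hi0⟩ j hj
    by_cases hk : T.IsInterior k
    · rw [← hi0]
      exact h.mem.2 k hk j hj i hi
    · rw [Finset.card_le_one.1 (not_lt.1 hk) j hj i hi]
      exact hi0
  -- The zero value travels from the root along a walk to `k`: across edges by constancy, across
  -- vertices by continuity.
  have hall : ∀ k, ∀ j ∈ T.adj k, T.trace k j (H2.toH1 (y j)) = 0 := by
    intro k
    obtain ⟨w⟩ := T.isTree.connected k T.root
    have h0 : ∀ j ∈ T.adj T.root, T.trace T.root j (H2.toH1 (y j)) = 0 := h.mem.1
    generalize T.root = r at w h0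
    induction w with
    | nil => exact h0
    | cons ha _ ih =>
      refine hstep _ ?_
      obtain ⟨j, hj⟩ := T.adj_iff.1 ha
      rw [Sym2.eq_iff] at hj
      rcases hj with ⟨e1, e2⟩ | ⟨e1, e2⟩
      · refine ⟨j, T.mem_adj.2 (Or.inl e1), ?_⟩
        rw [← e1, ← hends, e2]
        exact ih h0 j (T.mem_adj.2 (Or.inr e2))
      · refine ⟨j, T.mem_adj.2 (Or.inr e2), ?_⟩
        rw [← e2, hends, e1]
        exact ih h0 j (T.mem_adj.2 (Or.inl e1))
  have hj : j ∈ T.adj (T.init j) := T.mem_adj.2 (Or.inl rfl)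
  exact h.eq_zero_of_data hj (hall _ j hj) (by rw [slope_apply, hder, hd, mul_zero])

/-- On a Pi-tree there is no nonzero mode for a purely imaginary `λ`. -/
theorem eq_zero [Finite V] (hT : T.IsPiTree) {β : ℝ} (h : T.IsMode (Complex.I * β) y p) :
    y = 0 ∧ p = 0 := by
  by_cases hβ : β = 0
  · have h' : T.IsMode 0 y p := by rw [hβ] at h; simpa using h
    -- At `λ = 0` the flux condition says nothing about `p`; the node equation reduces to `p = 0`.
    refine ⟨funext h'.eq_zero_of_zero, funext fun k => by simpa using h'.node k⟩
  · have hy : ∀ j, y j = 0 := by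
      by_cases h1 : β ^ 2 = 1
      · exact h.eq_zero_of_eq_one hT (by simpa using h1)
      · exact h.eq_zero_of_sq_ne_one hβ h1
    exact ⟨funext hy, h.p_eq_zero (mul_ne_zero Complex.I_ne_zero (by exact_mod_cast hβ)) hy⟩

end IsMode

end MetricTree

/-! ### The boundary value problem as a square linear system -/

/-- The solution operator of the Cauchy problem `y'' = λ² y`, `(y(0), y'(0)) = c`. -/
lemma H2.exists_cauchyMap {ℓ : ℝ} (hℓ : 0 < ℓ) (lam : ℂ) :
    ∃ σ : ℂ × ℂ →ₗ[ℂ] H2 ℓ, Function.Injective σ ∧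
      ∀ c, (σ c).1.2.2 = lam ^ 2 • (σ c).1.1 := by
  set e₀ : Icc 0 ℓ := ⟨0, le_rfl, hℓ.le⟩
  -- Uniqueness makes the chosen solutions depend linearly on their Cauchy data.
  have huniq : ∀ y z : H2 ℓ, y.1.2.2 = lam ^ 2 • y.1.1 → z.1.2.2 = lam ^ 2 • z.1.1 →
      H1.eval hℓ e₀ (H2.toH1 y) = H1.eval hℓ e₀ (H2.toH1 z) →
      H1.eval hℓ e₀ (H2.deriv y) = H1.eval hℓ e₀ (H2.deriv z) → y = z := by
    intro y z hy hz h0 h1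
    refine sub_eq_zero.1 (H2.eq_zero_of_data (lam := lam) hℓ ?_ e₀.2 ?_ ?_)
    · change y.1.2.2 - z.1.2.2 = lam ^ 2 • (y.1.1 - z.1.1)
      rw [hy, hz, smul_sub]
    · change H1.eval hℓ e₀ (H2.toH1 (y - z)) = 0
      rw [map_sub, map_sub, h0, sub_self]
    · change H1.eval hℓ e₀ (H2.deriv (y - z)) = 0
      rw [map_sub, map_sub, h1, sub_self]
  have hex : ∀ c : ℂ × ℂ, ∃ y : H2 ℓ, y.1.2.2 = lam ^ 2 • y.1.1 ∧
      H1.eval hℓ e₀ (H2.toH1 y) = c.1 ∧ H1.eval hℓ e₀ (H2.deriv y) = c.2 := by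
    intro c
    obtain ⟨y, h, ha, hb⟩ := H2.exists_solution hℓ lam 0 c.1 c.2
    rw [add_zero] at h
    exact ⟨y, h, ha, hb⟩
  choose σ h h0 h1 using hex
  refine ⟨{ toFun := σ, map_add' := fun c d => ?_, map_smul' := fun r c => ?_ }, ?_, h⟩
  · refine huniq _ _ (h _) ?_ ?_ ?_
    · change (σ c).1.2.2 + (σ d).1.2.2 = lam ^ 2 • ((σ c).1.1 + (σ d).1.1)
      rw [h, h, smul_add]
    · rw [map_add, map_add, h0, h0, h0, Prod.fst_add]
    · rw [map_add, map_add, h1, h1, h1, Prod.snd_add]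
  · refine huniq _ _ (h _) ?_ ?_ ?_
    · change r • (σ c).1.2.2 = lam ^ 2 • (r • (σ c).1.1)
      rw [h, smul_comm]
    · rw [RingHom.id_apply, map_smul, map_smul, h0, h0, Prod.smul_fst]
    · rw [RingHom.id_apply, map_smul, map_smul, h1, h1, Prod.smul_snd]
  · intro c d hcd
    replace hcd : σ c = σ d := hcd
    exact Prod.ext (by rw [← h0, hcd, h0]) (by rw [← h1, hcd, h1])

namespace MetricTree

variable {V E : Type*} [Fintype E] (T : MetricTree V E)

/-- The edge at an interior vertex on which the value of a function is read off. -/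
def refEdge (k : T.Interior) : E := (T.adj_nonempty k).choose

lemma refEdge_mem (k : T.Interior) : T.refEdge k ∈ T.adj k.1 := (T.adj_nonempty k).choose_spec

/-- The value at a vertex of a function in `∏ H²`, taken on a given edge. -/
def value (k : V) (j : E) : ((∀ j, H2 (T.len j)) × (T.Interior → ℂ)) →ₗ[ℂ] ℂ :=
  T.trace k j ∘ₗ H2.toH1 ∘ₗ LinearMap.proj j ∘ₗ LinearMap.fst ℂ _ _

open Classical in
/-- The transmission and boundary conditions, one for each half-edge: the Dirichlet condition at
the root, the dissipative condition at the leaves, and at an interior vertex the flux condition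
for the reference edge and continuity for the others. -/
def condition (lam : ℂ) (k : V) (j : E) :
    ((∀ j, H2 (T.len j)) × (T.Interior → ℂ)) →ₗ[ℂ] ℂ :=
  if k = T.root then T.value k j
  else if h : T.IsInterior k then
    if j = T.refEdge ⟨k, h⟩ then
      T.flux k ∘ₗ LinearMap.fst ℂ _ _ - lam • (LinearMap.proj ⟨k, h⟩ ∘ₗ LinearMap.snd ℂ _ _)
    else T.value k j - T.value k (T.refEdge ⟨k, h⟩)
  else T.slope k j ∘ₗ LinearMap.proj j ∘ₗ LinearMap.fst ℂ _ _ + lam • T.value k j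

section condition

variable (lam : ℂ) (y : ∀ j, H2 (T.len j)) (p : T.Interior → ℂ)

lemma value_apply (k : V) (j : E) : T.value k j (y, p) = T.trace k j (H2.toH1 (y j)) := rfl

lemma condition_root (j : E) :
    T.condition lam T.root j (y, p) = T.trace T.root j (H2.toH1 (y j)) := by
  rw [condition, if_pos rfl, value_apply]

lemma condition_leaf {k : V} (hk : T.IsLeaf k) (j : E) :
    T.condition lam k j (y, p) = T.slope k j (y j) + lam * T.trace k j (H2.toH1 (y j)) := by
  rw [condition, if_neg hk.2, dif_neg hk.not_isInterior]
  rfl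

lemma interior_ne_root (k : T.Interior) : k.1 ≠ T.root := fun h =>
  T.not_isInterior_root (h ▸ k.2)

lemma condition_refEdge (k : T.Interior) :
    T.condition lam k.1 (T.refEdge k) (y, p) = T.flux k.1 y - lam * p k := by
  rw [condition, if_neg (T.interior_ne_root k), dif_pos k.2, if_pos rfl]
  rfl

lemma condition_ne (k : T.Interior) {j : E} (hj : j ≠ T.refEdge k) :
    T.condition lam k.1 j (y, p) = T.trace k.1 j (H2.toH1 (y j))
      - T.trace k.1 (T.refEdge k) (H2.toH1 (y (T.refEdge k))) := by
  rw [condition, if_neg (T.interior_ne_root k), dif_pos k.2, if_neg hj]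
  rfl

end condition

lemma toH1_mem {lam : ℂ} {y : ∀ j, H2 (T.len j)} {p : T.Interior → ℂ}
    (hr : ∀ j ∈ T.adj T.root, T.condition lam T.root j (y, p) = 0)
    (hi : ∀ k : T.Interior, ∀ j ∈ T.adj k.1, j ≠ T.refEdge k →
      T.condition lam k.1 j (y, p) = 0) : T.toH1 y ∈ T.VSpace := by
  refine ⟨fun j hj => ?_, fun k hk => ?_⟩
  · have := hr j hj
    rwa [condition_root] at this
  · have key : ∀ j ∈ T.adj k, T.trace k j (T.toH1 y j)
        = T.trace k (T.refEdge ⟨k, hk⟩) (T.toH1 y (T.refEdge ⟨k, hk⟩)) := by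
      intro j hj
      by_cases hjr : j = T.refEdge ⟨k, hk⟩
      · rw [← hjr]
      · have := hi ⟨k, hk⟩ j hj hjr
        rw [condition_ne _ _ _ _ _ hjr] at this
        exact sub_eq_zero.1 this
    intro i hi j hj
    rw [key i hi, key j hj]

/-- The Fredholm alternative: if there are no modes, the boundary value problem is solvable. -/
lemma exists_boundary_solution [Finite V] {lam : ℂ}
    (hinj : ∀ y p, T.IsMode lam y p → y = 0 ∧ p = 0) (g : ∀ j, L2 (T.len j)) (D : V → E → ℂ)
    (d : T.Interior → ℂ) :
    ∃ (y : ∀ j, H2 (T.len j)) (p : T.Interior → ℂ),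
      (∀ j, (y j).1.2.2 = lam ^ 2 • (y j).1.1 + g j) ∧
      (∀ k, ∀ j ∈ T.adj k, T.condition lam k j (y, p) = D k j) ∧
      ∀ k : T.Interior, (lam ^ 2 + 1) * p k
        + lam * T.trace k.1 (T.refEdge k) (H2.toH1 (y (T.refEdge k))) = d k := by
  classical
  cases nonempty_fintype V
  choose σ hσi hσ using fun j => H2.exists_cauchyMap (T.len_pos j) lam
  let S := (E → ℂ × ℂ) × (T.Interior → ℂ)
  let R := (E × Bool → ℂ) × (T.Interior → ℂ)
  let Ψ : ((∀ j, H2 (T.len j)) × (T.Interior → ℂ)) →ₗ[ℂ] R :=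
    (LinearMap.pi fun h : E × Bool =>
      T.condition lam (if h.2 then T.term h.1 else T.init h.1) h.1).prod
    (LinearMap.pi fun k => (lam ^ 2 + 1) • (LinearMap.proj k ∘ₗ LinearMap.snd ℂ _ _)
      + lam • T.value k.1 (T.refEdge k))
  let ι : S →ₗ[ℂ] ((∀ j, H2 (T.len j)) × (T.Interior → ℂ)) :=
    (LinearMap.pi fun j => σ j ∘ₗ LinearMap.proj j).prodMap
      LinearMap.id
  have hΨ : ∀ y p (r : R), Ψ (y, p) = r ↔
      (∀ j, T.condition lam (T.term j) j (y, p) = r.1 (j, true)) ∧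
      (∀ j, T.condition lam (T.init j) j (y, p) = r.1 (j, false)) ∧
      ∀ k : T.Interior, (lam ^ 2 + 1) * p k
        + lam * T.trace k.1 (T.refEdge k) (H2.toH1 (y (T.refEdge k))) = r.2 k := by
    intro y p r
    constructor
    · rintro rfl
      exact ⟨fun j => rfl, fun j => rfl, fun k => rfl⟩
    · rintro ⟨h1, h2, h3⟩
      refine Prod.ext (funext ?_) (funext h3)
      rintro ⟨j, _ | _⟩
      · exact h2 j
      · exact h1 j
  have hadj : ∀ y p (D : V → E → ℂ), (∀ j, T.condition lam (T.term j) j (y, p) = D (T.term j) j) →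
      (∀ j, T.condition lam (T.init j) j (y, p) = D (T.init j) j) →
      ∀ k, ∀ j ∈ T.adj k, T.condition lam k j (y, p) = D k j := by
    intro y p D h1 h2 k j hj
    rcases T.mem_adj.1 hj with rfl | rfl
    · exact h2 j
    · exact h1 j
  -- Both sides have dimension `2|E|` plus the number of interior vertices: two Cauchy data per edge
  -- against its two half-edges.
  have hdim : Module.finrank ℂ S = Module.finrank ℂ R := by
    simp only [S, R]
    rw [Module.finrank_prod, Module.finrank_prod, Module.finrank_pi_fintype,
      Module.finrank_fintype_fun_eq_card ℂ (η := E × Bool)]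
    simp
  have hinj' : Function.Injective (Ψ ∘ₗ ι) := by
    rw [← LinearMap.ker_eq_bot, LinearMap.ker_eq_bot']
    rintro ⟨n, p⟩ h0
    set y : ∀ j, H2 (T.len j) := fun j => σ j (n j) with hy
    obtain ⟨h1, h2, h3⟩ := (hΨ y p 0).1 h0
    have hc := hadj y p (fun _ _ => 0) h1 h2
    have hmem := T.toH1_mem (fun j hj => hc _ j hj) (fun k j hj _ => hc _ j hj)
    have hm : T.IsMode lam y p :=
      { ode := fun j => hσ j (n j)
        mem := hmem
        flux_eq := fun k => by
          have := hc k.1 _ (T.refEdge_mem k)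
          rw [condition_refEdge] at this
          exact sub_eq_zero.1 this
        leaf := fun k hk j hj => by
          have := hc k j hj
          rw [condition_leaf _ _ _ _ hk] at this
          exact eq_neg_of_add_eq_zero_left this
        node := h3 }
    obtain ⟨hy0, hp0⟩ := hinj y p hm
    refine Prod.ext (funext fun j => hσi j ?_) hp0
    rw [Prod.fst_zero, Pi.zero_apply, map_zero]
    exact congrFun hy0 j
  have hsurj := (LinearMap.injective_iff_surjective_of_finrank_eq_finrank hdim).1 hinj'
  -- A particular solution takes care of `g`; a homogeneous one then corrects the vertex data.
  choose y₀ hy₀ _ _ using fun j => H2.exists_solution (T.len_pos j) lam (g j) 0 0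
  obtain ⟨⟨n, p⟩, hn⟩ := hsurj
    ((fun h => D (if h.2 then T.term h.1 else T.init h.1) h.1, d) - Ψ (y₀, 0))
  have hsum : Ψ (y₀ + fun j => σ j (n j), p)
      = (fun h => D (if h.2 then T.term h.1 else T.init h.1) h.1, d) := by
    have e : (y₀ + fun j => σ j (n j), p) = ((y₀, 0) : _ × (T.Interior → ℂ)) + ι (n, p) :=
      Prod.ext rfl (zero_add p).symm
    rw [e, map_add]
    exact add_eq_of_eq_sub' hn
  obtain ⟨h1, h2, h3⟩ := (hΨ _ _ _).1 hsum
  refine ⟨_, p, fun j => ?_, hadj _ _ _ h1 h2, h3⟩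
  change (y₀ j).1.2.2 + (σ j (n j)).1.2.2 = lam ^ 2 • ((y₀ j).1.1 + (σ j (n j)).1.1) + g j
  rw [hy₀, hσ]
  module

end MetricTree

/-! ## Continuity of the resolvent -/

/-- Let `A` be the operator `i z ↦ g z`, where `i` and `g` are continuous on a closed subspace `D`
of a Banach space. If `λ i - g` is bijective, then `λ` is in the resolvent set of `A`. -/
lemma mem_resolventSet_of_bijective {P X : Type*} [NormedAddCommGroup P] [NormedSpace ℂ P]
    [CompleteSpace P] [NormedAddCommGroup X] [NormedSpace ℂ X] [CompleteSpace X]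
    (D : Submodule ℂ P) (hD : IsClosed (D : Set P)) (i g : D →ₗ[ℂ] X) (hi : Continuous i)
    (hg : Continuous g) (A : X →ₗ.[ℂ] X) (hdom : A.domain = LinearMap.range i)
    (hA : ∀ z (h : i z ∈ A.domain), A ⟨i z, h⟩ = g z) (lam : ℂ)
    (hker : ∀ z, lam • i z - g z = 0 → z = 0) (hsurj : ∀ x, ∃ z, lam • i z - g z = x) :
    lam ∈ resolventSet A := by
  have : CompleteSpace D := hD.isComplete.completeSpace_coe
  -- The bounded inverse theorem, applied on `D` with the norm of `P`; the resolvent is this inverse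
  -- followed by `i`.
  let e := (LinearEquiv.ofBijective (lam • i - g) ⟨(injective_iff_map_eq_zero _).2 hker, hsurj⟩
    ).toContinuousLinearEquivOfContinuous ((hi.const_smul lam).sub hg)
  have hmem : ∀ z, i z ∈ A.domain := fun z => hdom ▸ LinearMap.mem_range_self i z
  refine ⟨(⟨i, hi⟩ : D →L[ℂ] X).comp (e.symm : X →L[ℂ] D), fun x => ⟨hmem _, ?_⟩, ?_⟩
  · change lam • i (e.symm x) - A ⟨i (e.symm x), hmem _⟩ = x
    rw [hA]
    exact e.apply_symm_apply x
  · rintro ⟨x, hx⟩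
    obtain ⟨z, rfl⟩ : x ∈ LinearMap.range i := hdom ▸ hx
    rw [hA]
    exact congrArg i (e.symm_apply_apply z)

/-- An eigenvalue lies in the spectrum. -/
lemma mem_spectrum_of_eigenvector {X : Type*} [AddCommGroup X] [Module ℂ X] [TopologicalSpace X]
    (A : X →ₗ.[ℂ] X) {lam : ℂ} (x : A.domain) (hx : (x : X) ≠ 0) (h : A x = lam • (x : X)) :
    lam ∈ spectrum A := by
  rintro ⟨R, -, hR⟩
  have := hR x
  rw [h, sub_self, map_zero] at this
  exact hx this.symm

lemma continuous_setIntegral_smul {ℓ : ℝ} {φ : ℝ → ℝ} (hφ : Continuous φ)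
    (hc : HasCompactSupport φ) :
    Continuous fun f : L2 ℓ => ∫ x in Ioo 0 ℓ, φ x • f x := by
  rcases le_or_gt ℓ 0 with hℓ | hℓ
  · simp [Ioo_eq_empty (not_lt.mpr hℓ), continuous_const]
  obtain ⟨C, hC⟩ := hφ.bounded_above_of_compact_support hc
  let L : L2 ℓ →ₗ[ℂ] ℂ :=
    { toFun := fun f => ∫ x in Ioo 0 ℓ, φ x • f x
      map_add' := fun f g => by
        rw [← integral_add (integrable_smul_test hφ hc f) (integrable_smul_test hφ hc g)]
        refine integral_congr_ae ?_
        filter_upwards [Lp.coeFn_add f g] with x hx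
        rw [hx, Pi.add_apply, smul_add]
      map_smul' := fun c f => by
        rw [RingHom.id_apply, ← integral_smul]
        refine integral_congr_ae ?_
        filter_upwards [Lp.coeFn_smul c f] with x hx
        rw [hx, Pi.smul_apply, smul_comm] }
  refine AddMonoidHomClass.continuous_of_bound L (C * √ℓ) fun f => ?_
  refine (norm_integral_le_integral_norm _).trans ?_
  have hC0 : 0 ≤ C := (norm_nonneg _).trans (hC 0)
  calc ∫ x in Ioo 0 ℓ, ‖φ x • f x‖ ≤ ∫ x in Ioo 0 ℓ, C * ‖f x‖ := by
        refine integral_mono (integrable_smul_test hφ hc f).norm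
          ((L2.integrableOn f).norm.const_mul C) fun x => ?_
        simp only [norm_smul]
        gcongr
        exact hC x
    _ = C * ∫ x in Ioo 0 ℓ, ‖f x‖ := integral_const_mul _ _
    _ ≤ C * (√ℓ * ‖f‖) := by gcongr; exact L2.integral_norm_le hℓ f
    _ = C * √ℓ * ‖f‖ := by ring

/-- Each test function imposes an equation between continuous functionals. Closedness gives the
completeness of `H1` and `H2` that the bounded inverse theorem requires. -/
lemma isClosed_hasWeakDeriv {ℓ : ℝ} : IsClosed {u : L2 ℓ × L2 ℓ | HasWeakDeriv u.1 u.2} := by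
  simp only [HasWeakDeriv, ofPred_forall]
  refine isClosed_iInter fun φ => isClosed_iInter fun h1 => isClosed_iInter fun h2 =>
    isClosed_iInter fun _ => isClosed_eq ?_ ?_
  · exact (continuous_setIntegral_smul (h1.continuous_deriv (by simp)) h2.deriv).comp
      continuous_fst
  · exact ((continuous_setIntegral_smul h1.continuous h2).comp continuous_snd).neg

instance {ℓ : ℝ} : CompleteSpace (H1 ℓ) :=
  (isClosed_hasWeakDeriv (ℓ := ℓ)).isComplete.completeSpace_coe

instance {ℓ : ℝ} : CompleteSpace (H2 ℓ) := by
  have : IsClosed {u : L2 ℓ × L2 ℓ × L2 ℓ | HasWeakDeriv u.1 u.2.1 ∧ HasWeakDeriv u.2.1 u.2.2} :=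
    (isClosed_hasWeakDeriv.preimage (f := fun u : L2 ℓ × L2 ℓ × L2 ℓ => (u.1, u.2.1))
      (by fun_prop)).inter
    (isClosed_hasWeakDeriv.preimage (f := fun u : L2 ℓ × L2 ℓ × L2 ℓ => (u.2.1, u.2.2))
      (by fun_prop))
  exact this.isComplete.completeSpace_coe

lemma H2.continuous_toH1 {ℓ : ℝ} : Continuous (H2.toH1 (ℓ := ℓ)) :=
  Continuous.subtype_mk (f := fun u : H2 ℓ => (u.1.1, u.1.2.1)) (by fun_prop) _

lemma H2.continuous_deriv {ℓ : ℝ} : Continuous (H2.deriv (ℓ := ℓ)) :=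
  Continuous.subtype_mk (f := fun u : H2 ℓ => (u.1.2.1, u.1.2.2)) (by fun_prop) _

/-! ### The resolvent set and the eigenvalue `i` of the generator -/

namespace MetricTree

variable {V E : Type*} (T : MetricTree V E)

lemma continuous_trace (k : V) (j : E) : Continuous (T.trace k j) :=
  H1.continuous_eval (T.len_pos j) _

lemma continuous_slope (k : V) (j : E) : Continuous (T.slope k j) :=
  ((T.continuous_trace k j).comp H2.continuous_deriv).const_smul (T.inc k j)

lemma continuous_toH1 : Continuous T.toH1 :=
  continuous_pi fun j => H2.continuous_toH1.comp (continuous_apply j)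

variable [Fintype E]

lemma continuous_flux (k : V) : Continuous (T.flux k) := by
  have : (T.flux k : (∀ j, H2 (T.len j)) → ℂ) = fun y => ∑ j ∈ T.adj k, T.slope k j (y j) :=
    funext (T.flux_apply k)
  rw [this]
  exact continuous_finsetSum _ fun j _ => (T.continuous_slope k j).comp (continuous_apply j)

lemma isClosed_VSpace : IsClosed (T.VSpace : Set (∀ j, H1 (T.len j))) := by
  have h : ∀ k j, Continuous fun u : ∀ j, H1 (T.len j) => T.trace k j (u j) := fun k j =>
    (T.continuous_trace k j).comp (continuous_apply j)
  have e : (T.VSpace : Set (∀ j, H1 (T.len j))) =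
      {u | ∀ j ∈ T.adj T.root, T.trace T.root j (u j) = 0} ∩
      {u | ∀ k, T.IsInterior k → ∀ i ∈ T.adj k, ∀ j ∈ T.adj k,
        T.trace k i (u i) = T.trace k j (u j)} := rfl
  rw [e]
  simp only [ofPred_forall]
  refine IsClosed.inter ?_ ?_
  · exact isClosed_iInter fun j => isClosed_iInter fun _ => isClosed_eq (h _ _) continuous_const
  · exact isClosed_iInter fun k => isClosed_iInter fun _ => isClosed_iInter fun i =>
      isClosed_iInter fun _ => isClosed_iInter fun j => isClosed_iInter fun _ =>
      isClosed_eq (h _ _) (h _ _)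

instance : CompleteSpace T.VSpace := T.isClosed_VSpace.isComplete.completeSpace_coe

lemma continuous_nodeValue (k : T.Interior) : Continuous (T.nodeValue k) :=
  (T.continuous_trace k.1 _).comp ((continuous_apply _).comp continuous_subtype_val)

/-- The closure is taken in the `H²` and `H¹` topologies, where values and slopes at vertices are
continuous. -/
lemma isClosed_Domain : IsClosed (T.Domain : Set
    ((∀ j, H2 (T.len j)) × T.VSpace × (T.Interior → ℂ) × (T.Interior → ℂ))) := by
  have e : (T.Domain : Set ((∀ j, H2 (T.len j)) × T.VSpace × (T.Interior → ℂ) ×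
      (T.Interior → ℂ))) = {z | T.toH1 z.1 ∈ T.VSpace} ∩
      ({z | ∀ k : T.Interior, T.flux k.1 z.1 = z.2.2.2 k} ∩
      {z | ∀ k, T.IsLeaf k → ∀ j ∈ T.adj k,
        T.slope k j (z.1 j) = - T.trace k j (z.2.1.1 j)}) := rfl
  rw [e]
  simp only [ofPred_forall]
  refine (T.isClosed_VSpace.preimage (T.continuous_toH1.comp continuous_fst)).inter
    (IsClosed.inter ?_ ?_)
  · exact isClosed_iInter fun k => isClosed_eq ((T.continuous_flux k.1).comp continuous_fst)
      ((continuous_apply k).comp (continuous_snd.comp (continuous_snd.comp continuous_snd)))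
  · refine isClosed_iInter fun k => isClosed_iInter fun _ => isClosed_iInter fun j =>
      isClosed_iInter fun _ => isClosed_eq ?_ ?_
    · exact (T.continuous_slope k j).comp ((continuous_apply j).comp continuous_fst)
    · exact ((T.continuous_trace k j).comp ((continuous_apply j).comp
        (continuous_subtype_val.comp (continuous_fst.comp continuous_snd)))).neg

lemma continuous_incl : Continuous T.incl := by
  refine Continuous.prodMk (Continuous.subtype_mk ?_ _) (Continuous.prodMk ?_
    (Continuous.prodMk ?_ ?_))
  · exact T.continuous_toH1.comp (continuous_fst.comp continuous_subtype_val)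
  · exact continuous_pi fun j => continuous_fst.comp (continuous_subtype_val.comp
      ((continuous_apply j).comp (continuous_subtype_val.comp
      (continuous_fst.comp (continuous_snd.comp continuous_subtype_val)))))
  · fun_prop
  · fun_prop

lemma continuous_generatorMap : Continuous T.generatorMap := by
  refine Continuous.prodMk ?_ (Continuous.prodMk ?_ (Continuous.prodMk ?_ ?_))
  · fun_prop
  · fun_prop
  · fun_prop
  · refine continuous_pi fun k => Continuous.sub (by fun_prop) ?_
    exact (T.continuous_nodeValue k).comp (by fun_prop)

/-- The first and third equations give `v = λ y` and `q = λ p`; what remains says that `(y, p)` is a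
mode. -/
lemma eq_zero_of_resolvent_eq {lam : ℂ} (hinj : ∀ y p, T.IsMode lam y p → y = 0 ∧ p = 0)
    (z : T.Domain)
    (e1 : lam • (⟨T.toH1 z.1.1, z.2.1⟩ : T.VSpace) - z.1.2.1 = 0)
    (e2 : ∀ j, lam • (z.1.2.1.1 j).1.1 - (z.1.1 j).1.2.2 = 0)
    (e3 : ∀ k, lam * z.1.2.2.1 k - z.1.2.2.2 k = 0)
    (e4 : ∀ k, lam * z.1.2.2.2 k - (- z.1.2.2.1 k - T.nodeValue k z.1.2.1) = 0) : z = 0 := by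
  obtain ⟨⟨y, v, p, q⟩, hmem, hflux, hleaf⟩ := z
  have hv : v = lam • (⟨T.toH1 y, hmem⟩ : T.VSpace) := (sub_eq_zero.1 e1).symm
  have hq : ∀ k, q k = lam * p k := fun k => (sub_eq_zero.1 (e3 k)).symm
  have hvj : ∀ j, v.1 j = lam • H2.toH1 (y j) := fun j => by rw [hv]; rfl
  obtain ⟨hy0, hp0⟩ := hinj y p
    { ode := fun j => by
        rw [← sub_eq_zero.1 (e2 j), pow_two, mul_smul]
        exact congrArg (fun w => lam • w.1.1) (hvj j)
      mem := hmem
      flux_eq := fun k => (hflux k).trans (hq k)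
      leaf := fun k hk j hj => by
        rw [hleaf k hk j hj, hvj, map_smul, smul_eq_mul]
      node := fun k => by
        have h4 : lam * q k - (- p k - T.nodeValue k v) = 0 := e4 k
        rw [hv, map_smul, smul_eq_mul, hq] at h4
        linear_combination h4 }
  have hv0 : v = 0 := by
    refine Subtype.ext (funext fun j => ?_)
    rw [hvj, hy0, Pi.zero_apply, map_zero, smul_zero]
    rfl
  have hq0 : q = 0 := funext fun k => by rw [hq, hp0, Pi.zero_apply, mul_zero]
  exact Subtype.ext (Prod.ext hy0 (Prod.ext hv0 (Prod.ext hp0 hq0)))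

/-- Substituting `v = λ y - f` and `q = λ p - h` leaves `y'' = λ² y - (λ f + g)`, flux `λ p - h` at
interior vertices, leaf datum `f`, and node datum `r + λ h + f(a_k)`; these are the data passed to
`exists_boundary_solution`. -/
lemma exists_resolvent_eq [Finite V] {lam : ℂ}
    (hinj : ∀ y p, T.IsMode lam y p → y = 0 ∧ p = 0) (f : T.VSpace) (g : ∀ j, L2 (T.len j))
    (h r : T.Interior → ℂ) :
    ∃ z : T.Domain, lam • (⟨T.toH1 z.1.1, z.2.1⟩ : T.VSpace) - z.1.2.1 = f ∧
      (∀ j, lam • (z.1.2.1.1 j).1.1 - (z.1.1 j).1.2.2 = g j) ∧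
      (∀ k, lam * z.1.2.2.1 k - z.1.2.2.2 k = h k) ∧
      ∀ k, lam * z.1.2.2.2 k - (- z.1.2.2.1 k - T.nodeValue k z.1.2.1) = r k := by
  classical
  obtain ⟨y, p, hode, hcond, hnode⟩ := T.exists_boundary_solution hinj
    (fun j => - (lam • (f.1 j).1.1 + g j))
    (fun k j => if k = T.root then 0 else
      if hk : T.IsInterior k then (if j = T.refEdge ⟨k, hk⟩ then - h ⟨k, hk⟩ else 0)
      else T.trace k j (f.1 j))
    (fun k => r k + lam * h k + T.nodeValue k f)
  have hmem : T.toH1 y ∈ T.VSpace := T.toH1_mem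
    (fun j hj => by rw [hcond _ j hj, if_pos rfl])
    (fun k j hj hne => by
      rw [hcond _ j hj, if_neg (T.interior_ne_root k), dif_pos k.2, if_neg hne])
  have hflux : ∀ k : T.Interior, T.flux k.1 y = lam * p k - h k := fun k => by
    have := hcond k.1 _ (T.refEdge_mem k)
    rw [condition_refEdge, if_neg (T.interior_ne_root k), dif_pos k.2, if_pos rfl] at this
    linear_combination this
  have hleaf : ∀ k, T.IsLeaf k → ∀ j ∈ T.adj k, T.slope k j (y j)
      = - T.trace k j (lam • H2.toH1 (y j) - f.1 j) := fun k hk j hj => by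
    have := hcond k j hj
    rw [condition_leaf _ _ _ _ hk, if_neg hk.2, dif_neg hk.not_isInterior] at this
    rw [map_sub, map_smul, smul_eq_mul]
    linear_combination this
  refine ⟨⟨⟨y, lam • (⟨T.toH1 y, hmem⟩ : T.VSpace) - f, p, fun k => lam * p k - h k⟩,
    hmem, hflux, hleaf⟩, ?_⟩
  refine ⟨?_, fun j => ?_, fun k => ?_, fun k => ?_⟩
  · exact sub_sub_cancel _ f
  · change lam • (lam • (y j).1.1 - (f.1 j).1.1) - (y j).1.2.2 = g j
    rw [hode j]
    module
  · exact sub_sub_cancel (lam * p k) (h k)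
  · change lam * (lam * p k - h k)
      - (- p k - T.nodeValue k (lam • (⟨T.toH1 y, hmem⟩ : T.VSpace) - f)) = r k
    have e : T.nodeValue k (lam • (⟨T.toH1 y, hmem⟩ : T.VSpace) - f)
        = lam * T.trace k.1 (T.refEdge k) (H2.toH1 (y (T.refEdge k))) - T.nodeValue k f := by
      rw [T.nodeValue_eq k _ (T.refEdge_mem k), T.nodeValue_eq k f (T.refEdge_mem k)]
      change T.trace k.1 (T.refEdge k) (lam • H2.toH1 (y (T.refEdge k)) - f.1 (T.refEdge k)) = _
      rw [map_sub, map_smul, smul_eq_mul]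
    rw [e]
    linear_combination hnode k

lemma generator_apply (z : T.Domain) (h : T.incl z ∈ T.generator.domain) :
    T.generator ⟨T.incl z, h⟩ = T.generatorMap z := by
  change T.generatorMap ((LinearEquiv.ofInjective T.incl T.incl_injective).symm ⟨T.incl z, h⟩) = _
  congr 1
  rw [LinearEquiv.symm_apply_eq]
  rfl

set_option maxHeartbeats 4000000 in
/-- In the absence of modes, `λ` lies in the resolvent set. -/
lemma mem_resolventSet [Finite V] {lam : ℂ} (hinj : ∀ y p, T.IsMode lam y p → y = 0 ∧ p = 0) :
    lam ∈ resolventSet T.generator := by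
  cases nonempty_fintype V
  cases nonempty_fintype T.Interior
  refine mem_resolventSet_of_bijective
    (P := (∀ j, H2 (T.len j)) × T.VSpace × (T.Interior → ℂ) × (T.Interior → ℂ))
    (X := T.State) T.Domain T.isClosed_Domain T.incl T.generatorMap T.continuous_incl
    T.continuous_generatorMap T.generator rfl T.generator_apply lam (fun z h0 => ?_) ?_
  · exact T.eq_zero_of_resolvent_eq hinj z (congrArg Prod.fst h0)
      (congrFun (congrArg (fun s : T.State => s.2.1) h0))
      (congrFun (congrArg (fun s : T.State => s.2.2.1) h0))
      (congrFun (congrArg (fun s : T.State => s.2.2.2) h0))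
  · rintro ⟨f, g, h, r⟩
    obtain ⟨z, h1, h2, h3, h4⟩ := T.exists_resolvent_eq hinj f g h r
    exact ⟨z, Prod.ext h1 (Prod.ext (funext h2) (Prod.ext (funext h3) (funext h4)))⟩

/-- An inner edge of length `mπ` carries an eigenfunction for the eigenvalue `i`. -/
lemma I_mem_spectrum {j₀ : E} (h1 : ¬ T.IsLeaf (T.init j₀)) (h2 : ¬ T.IsLeaf (T.term j₀)) {m : ℕ}
    (hm : T.len j₀ = m * Real.pi) : Complex.I ∈ spectrum T.generator := by
  classical
  obtain ⟨u, hu, hu0, hul, hud⟩ := H2.exists_dirichlet (T.len_pos j₀) hm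
  set y : ∀ j, H2 (T.len j) := Pi.single j₀ u with hy
  have hyj : y j₀ = u := Pi.single_eq_same _ _
  have hyn : ∀ j, j ≠ j₀ → y j = 0 := fun j hj => Pi.single_eq_of_ne hj _
  have htr : ∀ k, ∀ j ∈ T.adj k, T.trace k j (H2.toH1 (y j)) = 0 := by
    intro k j hj
    by_cases hjj : j = j₀
    · subst hjj
      rw [hyj]
      rcases T.mem_adj.1 hj with rfl | rfl
      · rw [trace_init, hu0]
      · rw [trace_term, hul]
    · rw [hyn j hjj, map_zero, map_zero]
  have hmem : T.toH1 y ∈ T.VSpace :=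
    ⟨fun j hj => htr _ j hj, fun k _ i hi j hj => (htr k i hi).trans (htr k j hj).symm⟩
  set v : T.VSpace := Complex.I • (⟨T.toH1 y, hmem⟩ : T.VSpace) with hv
  have hvtr : ∀ k, ∀ j ∈ T.adj k, T.trace k j (v.1 j) = 0 := fun k j hj => by
    change T.trace k j (Complex.I • H2.toH1 (y j)) = 0
    rw [map_smul, htr k j hj, smul_zero]
  have hode : ∀ j, (y j).1.2.2 = Complex.I ^ 2 • (y j).1.1 := by
    intro j
    by_cases hjj : j = j₀
    · subst hjj; rw [hyj, hu]
    · rw [hyn j hjj]; exact (smul_zero _).symm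
  have hleaf : ∀ k, T.IsLeaf k → ∀ j ∈ T.adj k,
      T.slope k j (y j) = - T.trace k j (v.1 j) := by
    intro k hk j hj
    rw [hvtr k j hj, neg_zero]
    by_cases hjj : j = j₀
    · subst hjj
      rcases T.mem_adj.1 hj with rfl | rfl
      · exact absurd hk h1
      · exact absurd hk h2
    · rw [hyn j hjj, map_zero]
  -- The domain forces `q` to be the flux, and `q = i p` then gives `p = -i q`. The last equation
  -- holds because `v` vanishes at the vertices.
  let z : T.Domain := ⟨⟨y, v, fun k => -(Complex.I * T.flux k.1 y), fun k => T.flux k.1 y⟩,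
    hmem, fun _ => rfl, hleaf⟩
  have hz : T.incl z ∈ T.generator.domain := ⟨z, rfl⟩
  refine mem_spectrum_of_eigenvector T.generator ⟨T.incl z, hz⟩ ?_ ?_
  · intro h0
    have : T.toH1 y = 0 := congrArg (fun s : T.State => s.1.1) h0
    have hu0 : u = 0 := by
      rw [← hyj]
      exact H2.eq_zero_of_toH1 (congrFun this j₀)
    rw [hu0] at hud
    have h0 : H1.eval (T.len_pos j₀) ⟨0, le_rfl, (T.len_pos j₀).le⟩
        (H2.deriv (0 : H2 (T.len j₀))) = 0 := by
      rw [map_zero, map_zero]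
    exact zero_ne_one (h0.symm.trans hud)
  · rw [T.generator_apply]
    refine Prod.ext rfl (Prod.ext (funext fun j => ?_) (Prod.ext (funext fun k => ?_)
      (funext fun k => ?_)))
    · change (y j).1.2.2 = Complex.I • (Complex.I • (y j).1.1)
      rw [hode, pow_two, mul_smul]
    · change T.flux k.1 y = Complex.I * -(Complex.I * T.flux k.1 y)
      linear_combination (T.flux k.1 y) * Complex.I_mul_I
    · change - -(Complex.I * T.flux k.1 y) - T.nodeValue k v = Complex.I * T.flux k.1 y
      rw [T.nodeValue_eq k v (T.refEdge_mem k), hvtr _ _ (T.refEdge_mem k)]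
      ring

end MetricTree

end FluidTree

end

theorem lemma3p1 {V E : Type*} [Finite V] [Fintype E] (T : FluidTree.MetricTree V E) :
    (∀ β : ℝ, Complex.I * (β : ℂ) ∉ FluidTree.spectrum T.generator) ↔ T.IsPiTree := by
  constructor
  · intro h j h1 h2 m _ hlen
    refine h 1 ?_
    rw [Complex.ofReal_one, mul_one]
    exact T.I_mem_spectrum h1 h2 hlen
  · intro hT β hβ
    exact hβ (T.mem_resolventSet fun y p h => h.eq_zero hT)
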